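/- Let $1\le r<\infty$, let $r'\in(1,\infty]$ be given by $\frac1r+\frac1{r'}=1$ ($r'=\infty$ if $r=1$), and let $F$ be a Banach space over $\mathbb K=\mathbb R$ or $\mathbb C$. *Definitions.* Operators are bounded and linear. For $1\le p\le\infty$ an operator $S:F\to G$ into a Banach space $G$ over $\mathbb K$ is *$p$-summing* if there is $c\ge 0$ such that for all $x_1,\dots,x_n\in F$ $$\Bigl(\sum_k\|Sx_k\|^p\Bigr)^{1/p}\le c\,\sup_{x'\in F',\,\|x'\|\le1}\Bigl(\sum_k|x'(x_k)|^p\Bigr)^{1/p}$$ (maxima over $k$ instead of the sums if $p=\infty$, so that every operator is $\infty$-summing). Banach lattices are real; an operator from a real space into $F$ is a bounded real-linear map. An operator $T:X\to F$ on a Banach lattice $X$ is *$r$-concave* if there is $c\ge0$ such that $\bigl(\sum_k\|Tx_k\|^r\bigr)^{1/r}\le c\,\bigl\|\bigl(\sum_k|x_k|^r\bigr)^{1/r}\bigr\|_X$ for all $x_1,\dots,x_n\in X$, where $\bigl(\sum_k|x_k|^r\bigr)^{1/r}\in X$ is defined by the Krivine functional calculus. Let $(\Omega,\Sigma,\mu)$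 be a $\sigma$-finite complete measure space and $L_0(\mu)$ the space of classes of real measurable functions modulo equality $\mu$-a.e. A *quasi Banach function space* $X(\mu)$ is a complete quasi normed space $(X,\|\cdot\|_X)$, $X$ a linear subspace of $L_0(\mu)$, such that (I) if $|x|\le|y|$ a.e., $x\in L_0(\mu)$, $y\in X$, then $x\in X$ and $\|x\|_X\le\|y\|_X$; (II) for some $0<t<\infty$, $\|(|x|^t+|y|^t)^{1/t}\|_X\le(\|x\|_X^t+\|y\|_X^t)^{1/t}$ for all $x,y\in X$; (III) every measurable set on which all functions in $X$ vanish a.e. is a null set, and $\|x_n\|_X\to\|x\|_X$ whenever $0\le x_n\in X$, $0\le x\in X$ and $x_n\uparrow x$ a.e. It is *$r$-convex* if there is $c\ge 0$ with $\|(\sum_k|x_k|^r)^{1/r}\|_X\le c\,(\sum_k\|x_k\|_X^r)^{1/r}$ for all $x_1,\dots,x_n\in X$. Its $r$-th power is the vector space $X^r:=\{x\in L_0(\mu): |x|^{1/r}\in X\}$. **Statement.** The following are equivalent: 1. Every $r'$-summing operator from $F$ into a Banach space is $1$-summing (the identity on $F$ is $(r',1)$-mixing). 2. Every operator $T:X\to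 F$, $X$ a Banach lattice, is $r$-concave. 3. For every operator $T:X(\mu)\to F$, $X(\mu)$ an $r$-convex quasi Banach function space, there is a positive linear functional $\varphi:X^r\to\mathbb R$ with $\sup_{\|x\|_X\le1}\varphi(|x|^r)^{1/r}<\infty$ such that for all $x\in X$ $$\|Tx\|_F\le\varphi(|x|^r)^{1/r}.$$ -/

import Mathlib

open MeasureTheory Filter Topology
open scoped ENNReal

noncomputable section

/-! ### Absolutely summing operators -/

/-- The weak `ℓ_p`-norm `sup_{‖φ‖ ≤ 1} ‖(φ (x₁), …, φ (xₙ))‖_p` of a finite family of vectors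
(the `ℓ_p`-norm being the maximum when `p = ∞`). -/
def weakLpNorm (𝕜 : Type*) [RCLike 𝕜] {E : Type*} [NormedAddCommGroup E] [NormedSpace 𝕜 E]
    (p : ℝ≥0∞) {n : ℕ} (x : Fin n → E) : ℝ :=
  ⨆ φ : Metric.closedBall (0 : E →L[𝕜] 𝕜) 1,
    ‖(WithLp.toLp p (fun k => φ.1 (x k)) : PiLp p (fun _ : Fin n => 𝕜))‖

/-- `p`-summing operators, `1 ≤ p ≤ ∞`. -/
def IsSumming {𝕜 : Type*} [RCLike 𝕜] {E G : Type*} [NormedAddCommGroup E] [NormedSpace 𝕜 E]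
    [NormedAddCommGroup G] [NormedSpace 𝕜 G] (p : ℝ≥0∞) (S : E →L[𝕜] G) : Prop :=
  ∃ c : ℝ, 0 ≤ c ∧ ∀ (n : ℕ) (x : Fin n → E),
    ‖(WithLp.toLp p (fun k => S (x k)) : PiLp p (fun _ : Fin n => G))‖ ≤ c * weakLpNorm 𝕜 p x

/-! ### The homogeneous functional calculus of a Banach lattice and `r`-concave operators -/

/-- Continuous functions on `ℝⁿ` which are positively homogeneous of degree one. -/
def homogFun (n : ℕ) : Submodule ℝ ((Fin n → ℝ) → ℝ) where
  carrier := {f | Continuous f ∧ ∀ c : ℝ, 0 ≤ c → ∀ s, f (c • s) = c * f s}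
  add_mem' {f g} hf hg :=
    ⟨hf.1.add hg.1, fun c hc s => by simp [hf.2 c hc s, hg.2 c hc s, mul_add]⟩
  zero_mem' := ⟨continuous_const, fun c _ s => by simp⟩
  smul_mem' a f hf :=
    ⟨hf.1.const_smul a, fun c hc s => by simp [hf.2 c hc s, mul_left_comm]⟩

namespace homogFun

variable {n : ℕ}

/-- The `i`-th coordinate function. -/
def coord (i : Fin n) : homogFun n :=
  ⟨fun s => s i, continuous_apply i, fun c _ s => by simp⟩

/-- The pointwise maximum of two functions. -/
def max (f g : homogFun n) : homogFun n :=
  ⟨fun s => f.1 s ⊔ g.1 s, f.2.1.sup g.2.1, fun c hc s => by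
    change f.1 (c • s) ⊔ g.1 (c • s) = c * (f.1 s ⊔ g.1 s)
    rw [f.2.2 c hc s, g.2.2 c hc s, mul_max_of_nonneg _ _ hc]⟩

/-- The function `s ↦ (∑ |sₖ|^r)^(1/r)`. -/
def powerSum (n : ℕ) {r : ℝ} (hr : 0 < r) : homogFun n :=
  ⟨fun s => (∑ k, |s k| ^ r) ^ (1 / r), by
    refine ⟨?_, ?_⟩
    · have h1 : ∀ s : Fin n → ℝ, ∀ k, |s k| ≠ 0 ∨ 0 ≤ r := fun _ _ => Or.inr hr.le
      refine Continuous.rpow_const ?_ fun _ => Or.inr (by positivity)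
      exact continuous_finsetSum _ fun k _ =>
        (continuous_abs.comp (continuous_apply k)).rpow_const fun s => h1 s k
    · intro c hc s
      have h : ∀ k, |(c • s) k| ^ r = c ^ r * |s k| ^ r := fun k => by
        rw [Pi.smul_apply, smul_eq_mul, abs_mul, abs_of_nonneg hc,
          Real.mul_rpow hc (abs_nonneg _)]
      have h0 : 0 ≤ ∑ k, |s k| ^ r :=
        Finset.sum_nonneg fun k _ => Real.rpow_nonneg (abs_nonneg _) _
      simp only [h]
      rw [← Finset.mul_sum, Real.mul_rpow (Real.rpow_nonneg hc _) h0, ← Real.rpow_mul hc,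
        mul_one_div_cancel hr.ne', Real.rpow_one]⟩

end homogFun

/-- `y = h(x₁, …, xₙ)` in the sense of the (Krivine) functional calculus of a Banach lattice `X`:
`y` is the image of `h` under the linear lattice homomorphism `homogFun n → X` which sends the
`i`-th coordinate function to `xᵢ`. (In a Banach lattice this homomorphism exists and is unique.
A linear map that preserves binary suprema preserves infima as well.) -/
def IsKrivineValue {X : Type*} [NormedAddCommGroup X] [NormedSpace ℝ X] [Lattice X]
    {n : ℕ} (h : homogFun n) (x : Fin n → X) (y : X) : Prop :=
  ∃ τ : homogFun n →ₗ[ℝ] X,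
    (∀ f g, τ (homogFun.max f g) = τ f ⊔ τ g) ∧
    (∀ i, τ (homogFun.coord i) = x i) ∧ τ h = y

/-- An operator from a Banach lattice into a Banach space is `r`-concave if
`(∑ ‖T xₖ‖^r)^(1/r) ≤ c ‖(∑ |xₖ|^r)^(1/r)‖`. -/
def IsConcaveOperator {X F : Type*} [NormedAddCommGroup X] [NormedSpace ℝ X] [Lattice X]
    [NormedAddCommGroup F] [NormedSpace ℝ F] {r : ℝ} (hr : 0 < r) (T : X →L[ℝ] F) : Prop :=
  ∃ c : ℝ, 0 ≤ c ∧ ∀ (n : ℕ) (x : Fin n → X) (y : X),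
    IsKrivineValue (homogFun.powerSum n hr) x y →
      (∑ k, ‖T (x k)‖ ^ r) ^ (1 / r) ≤ c * ‖y‖

/-! ### Quasi Banach function spaces -/

section FunctionSpaces

variable {Ω : Type*} [MeasurableSpace Ω] {μ : Measure Ω}

/-- `|x|^t` for a class `x` of measurable functions. -/
def absPow (t : ℝ) (x : Ω →ₘ[μ] ℝ) : Ω →ₘ[μ] ℝ :=
  AEEqFun.compMeasurable (fun a : ℝ => |a| ^ t) (measurable_norm.pow_const t) x

theorem coeFn_absPow (t : ℝ) (x : Ω →ₘ[μ] ℝ) :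
    ∀ᵐ ω ∂μ, absPow t x ω = |x ω| ^ t :=
  AEEqFun.coeFn_compMeasurable _ _ x

/-- A quasi Köthe function space over `μ`: a quasi normed space of (classes of) real measurable
functions. The values of `qnorm` outside of `carrier` are irrelevant. -/
structure QuasiKotheSpace (μ : Measure Ω) where
  /-- the functions in the space -/
  carrier : Submodule ℝ (Ω →ₘ[μ] ℝ)
  /-- the quasi norm -/
  qnorm : (Ω →ₘ[μ] ℝ) → ℝ
  qnorm_nonneg : ∀ x ∈ carrier, 0 ≤ qnorm x
  eq_zero_of_qnorm : ∀ x ∈ carrier, qnorm x = 0 → x = 0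
  qnorm_smul : ∀ (a : ℝ), ∀ x ∈ carrier, qnorm (a • x) = |a| * qnorm x
  qnorm_add : ∃ K : ℝ, ∀ x ∈ carrier, ∀ y ∈ carrier, qnorm (x + y) ≤ K * (qnorm x + qnorm y)
  solid : ∀ x, ∀ y ∈ carrier, |x| ≤ |y| → x ∈ carrier ∧ qnorm x ≤ qnorm y
  lower_convex : ∃ t : ℝ, 0 < t ∧ ∀ x ∈ carrier, ∀ y ∈ carrier,
    qnorm (absPow (1 / t) (absPow t x + absPow t y)) ≤ (qnorm x ^ t + qnorm y ^ t) ^ (1 / t)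
  /-- the support of the space is all of `Ω` -/
  full_support : ∀ A : Set Ω, MeasurableSet A →
    (∀ x ∈ carrier, ∀ᵐ ω ∂μ, ω ∈ A → x ω = 0) → μ A = 0
  /-- the Fatou property -/
  fatou : ∀ (u : ℕ → Ω →ₘ[μ] ℝ) (x : Ω →ₘ[μ] ℝ), (∀ n, u n ∈ carrier) → x ∈ carrier →
    (∀ n, 0 ≤ u n) → 0 ≤ x → Monotone u →
    (∀ᵐ ω ∂μ, Tendsto (fun n => u n ω) atTop (𝓝 (x ω))) →
    Tendsto (fun n => qnorm (u n)) atTop (𝓝 (qnorm x))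

/-- A quasi Banach function space is a complete quasi Köthe function space. -/
structure QuasiBanachFunctionSpace (μ : Measure Ω) extends QuasiKotheSpace μ where
  complete : ∀ u : ℕ → Ω →ₘ[μ] ℝ, (∀ n, u n ∈ carrier) →
    (∀ ε : ℝ, 0 < ε → ∃ N, ∀ m ≥ N, ∀ n ≥ N, qnorm (u m - u n) < ε) →
    ∃ x ∈ carrier, Tendsto (fun n => qnorm (u n - x)) atTop (𝓝 0)

namespace QuasiKotheSpace

/-- `r`-convexity. -/
def IsConvex (X : QuasiKotheSpace μ) (r : ℝ) : Prop :=
  ∃ c : ℝ, 0 ≤ c ∧ ∀ (n : ℕ) (x : Fin n → Ω →ₘ[μ] ℝ), (∀ k, x k ∈ X.carrier) →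
    X.qnorm (absPow (1 / r) (∑ k, absPow r (x k))) ≤ c * (∑ k, X.qnorm (x k) ^ r) ^ (1 / r)

/-- The `r`-th power `X^r = {x ∈ L₀ : |x|^(1/r) ∈ X}`, a vector space of functions. -/
def power (X : QuasiKotheSpace μ) {r : ℝ} (hr : 0 < r) : Submodule ℝ (Ω →ₘ[μ] ℝ) where
  carrier := {x | absPow (1 / r) x ∈ X.carrier}
  add_mem' {x y} hx hy := by
    have hr' : 0 ≤ 1 / r := by positivity
    have hmem : (2 : ℝ) ^ (1 / r) • (absPow (1 / r) x + absPow (1 / r) y) ∈ X.carrier :=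
      X.carrier.smul_mem _ (X.carrier.add_mem hx hy)
    refine (X.solid _ _ hmem ?_).1
    rw [← AEEqFun.coeFn_le]
    filter_upwards [AEEqFun.coeFn_abs (absPow (1 / r) (x + y)), coeFn_absPow (1 / r) (x + y),
      AEEqFun.coeFn_add x y, coeFn_absPow (1 / r) x, coeFn_absPow (1 / r) y,
      AEEqFun.coeFn_abs ((2 : ℝ) ^ (1 / r) • (absPow (1 / r) x + absPow (1 / r) y)),
      AEEqFun.coeFn_smul ((2 : ℝ) ^ (1 / r)) (absPow (1 / r) x + absPow (1 / r) y),
      AEEqFun.coeFn_add (absPow (1 / r) x) (absPow (1 / r) y)] with ω h1 h2 h3 h4 h5 h6 h7 h8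
    rw [h1, h2, h3, h6, h7, Pi.smul_apply, h8, Pi.add_apply, Pi.add_apply, h4, h5, smul_eq_mul]
    have ha := abs_nonneg (x ω)
    have hb := abs_nonneg (y ω)
    rw [abs_of_nonneg (Real.rpow_nonneg (abs_nonneg (x ω + y ω)) (1 / r)),
      abs_of_nonneg (a := (2 : ℝ) ^ (1 / r) * (|x ω| ^ (1 / r) + |y ω| ^ (1 / r))) (by positivity)]
    rcases le_total |x ω| |y ω| with h | h
    · calc |x ω + y ω| ^ (1 / r) ≤ (2 * |y ω|) ^ (1 / r) :=
            Real.rpow_le_rpow (abs_nonneg _) ((abs_add_le _ _).trans (by linarith)) hr'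
        _ = 2 ^ (1 / r) * |y ω| ^ (1 / r) := Real.mul_rpow (by norm_num) hb
        _ ≤ _ := by
            gcongr
            exact le_add_of_nonneg_left (Real.rpow_nonneg ha _)
    · calc |x ω + y ω| ^ (1 / r) ≤ (2 * |x ω|) ^ (1 / r) :=
            Real.rpow_le_rpow (abs_nonneg _) ((abs_add_le _ _).trans (by linarith)) hr'
        _ = 2 ^ (1 / r) * |x ω| ^ (1 / r) := Real.mul_rpow (by norm_num) ha
        _ ≤ _ := by
            gcongr
            exact le_add_of_nonneg_right (Real.rpow_nonneg hb _)
  zero_mem' := by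
    have h : absPow (1 / r) (0 : Ω →ₘ[μ] ℝ) = 0 := by
      apply AEEqFun.ext
      filter_upwards [coeFn_absPow (1 / r) (0 : Ω →ₘ[μ] ℝ),
        AEEqFun.coeFn_zero (α := Ω) (β := ℝ) (μ := μ)] with ω h1 h2
      rw [h1, h2, Pi.zero_apply, abs_zero, Real.zero_rpow (by positivity)]
    rw [Set.mem_ofPred_eq, h]
    exact X.carrier.zero_mem
  smul_mem' a x hx := by
    have h : absPow (1 / r) (a • x) = |a| ^ (1 / r) • absPow (1 / r) x := by
      apply AEEqFun.ext
      filter_upwards [coeFn_absPow (1 / r) (a • x), AEEqFun.coeFn_smul a x,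
        AEEqFun.coeFn_smul (|a| ^ (1 / r)) (absPow (1 / r) x),
        coeFn_absPow (1 / r) x] with ω h1 h2 h3 h4
      rw [h1, h2, h3, Pi.smul_apply, Pi.smul_apply, h4, smul_eq_mul, smul_eq_mul, abs_mul,
        Real.mul_rpow (abs_nonneg _) (abs_nonneg _)]
    rw [Set.mem_ofPred_eq, h]
    exact X.carrier.smul_mem _ hx

/-- The map `X → X^r`, `x ↦ |x|^r`. -/
def absPowMap (X : QuasiKotheSpace μ) {r : ℝ} (hr : 0 < r) (x : X.carrier) : X.power hr :=
  ⟨absPow r x.1, by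
    change absPow (1 / r) (absPow r x.1) ∈ X.carrier
    refine (X.solid _ _ x.2 ?_).1
    rw [← AEEqFun.coeFn_le]
    filter_upwards [AEEqFun.coeFn_abs (absPow (1 / r) (absPow r x.1)),
      coeFn_absPow (1 / r) (absPow r x.1), coeFn_absPow r x.1,
      AEEqFun.coeFn_abs x.1] with ω h1 h2 h3 h4
    rw [h1, h2, h3, h4, abs_of_nonneg (Real.rpow_nonneg (abs_nonneg (x.1 ω)) r),
      ← Real.rpow_mul (abs_nonneg _), mul_one_div_cancel hr.ne', Real.rpow_one, abs_abs]⟩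

end QuasiKotheSpace

end FunctionSpaces

end

open scoped BoundedContinuousFunction

/-! All three properties are equivalent to one finite-dimensional statement, `LocallyConcave`:
operators from `ℓ_∞ⁿ` into `F` are `r`-concave with a constant that does not depend on `n`. Every
implication passes through it.

From summing operators to the local statement: a sequence `y` in `ℓ_{r'}(F')` defines the
`r'`-summing operator `x ↦ (y_k(x))_k` into `ℓ_{r'}`. If it is `1`-summing, the functionals `y ↦ ∑_k
y_k(∑_i a_ik x_i)`, taken over normalized finite data `x, a`, are bounded at each `y`.
Banach–Steinhaus makes the bound uniform, and a norming `y` turns it into local concavity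
(`exists_locallyConcave_of_isSumming`). Conversely, for `r > 1`, Pietsch domination on finitely many
vectors replaces an `r'`-summing operator by finitely many functionals, and `ℓ_r`-`ℓ_{r'}` duality
reduces the claim to local concavity (`LocallyConcave.isSumming_one`).

From lattices or function spaces to the local statement: both properties, applied to bounded
sequences, make each single operator on `ℓ_∞` `r`-concave. Since the operators from `ℓ_∞` into `F`
form a Banach space, the constants are uniform, and `ℓ_∞ⁿ` sits inside `ℓ_∞`
(`ConcaveOnBoundedSequences.exists_locallyConcave`).

From the local statement back to lattices: the functional calculus moves the problem to homogeneous
functions on `ℝᵐ`. A homogeneous partition of unity approximates the coordinates by combinations of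
finitely many positive functions whose sum is the `r`-norm, so that an `ℓ_∞ⁿ` appears
(`homogFun.exists_partition`, `LocallyConcave.sum_coord`). On an `r`-convex function space the
resulting `r`-concavity of `T` leaves room between `‖Tx‖^r` and a multiple of `‖x‖^r` for a positive
functional of `|x|^r`, found by a Hahn–Banach sandwich argument
(`exists_positive_functional_between`). -/

theorem RCLike.norm_I_le_one {𝕜 : Type*} [RCLike 𝕜] : ‖(RCLike.I : 𝕜)‖ ≤ 1 := by
  rw [RCLike.norm_I]
  split_ifs <;> norm_num

theorem RCLike.norm_le_abs_re_add_abs_im {𝕜 : Type*} [RCLike 𝕜] (z : 𝕜) :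
    ‖z‖ ≤ |RCLike.re z| + |RCLike.im z| := by
  conv_lhs => rw [← RCLike.re_add_im z]
  refine (norm_add_le _ _).trans ?_
  rw [norm_mul, RCLike.norm_ofReal, RCLike.norm_ofReal]
  exact add_le_add le_rfl (mul_le_of_le_one_right (abs_nonneg _) RCLike.norm_I_le_one)

/-! ### Weak norms -/

section WeakNorm

variable {𝕜 : Type*} [RCLike 𝕜] {E : Type*} [NormedAddCommGroup E] [NormedSpace 𝕜 E]

theorem bddAbove_weakLpNorm (p : ℝ≥0∞) [Fact (1 ≤ p)] {n : ℕ} (x : Fin n → E) :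
    BddAbove (Set.range fun φ : Metric.closedBall (0 : E →L[𝕜] 𝕜) 1 =>
      ‖(WithLp.toLp p (fun k => φ.1 (x k)) : PiLp p (fun _ : Fin n => 𝕜))‖) := by
  refine ⟨∑ k, ‖x k‖, ?_⟩
  rintro _ ⟨φ, rfl⟩
  have hφ : ‖φ.1‖ ≤ 1 := mem_closedBall_zero_iff.1 φ.2
  have h : (WithLp.toLp p (fun k => φ.1 (x k)) : PiLp p (fun _ : Fin n => 𝕜))
      = ∑ k, PiLp.single p k (φ.1 (x k)) := by
    ext j
    simp [Finset.sum_apply, Pi.single_apply]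
  simp only [h]
  refine (norm_sum_le _ _).trans (Finset.sum_le_sum fun k _ => ?_)
  rw [PiLp.norm_single]
  exact (φ.1.le_opNorm _).trans (mul_le_of_le_one_left (norm_nonneg _) hφ)

theorem norm_le_weakLpNorm (p : ℝ≥0∞) [Fact (1 ≤ p)] {n : ℕ} (x : Fin n → E)
    {φ : E →L[𝕜] 𝕜} (hφ : ‖φ‖ ≤ 1) :
    ‖(WithLp.toLp p (fun k => φ (x k)) : PiLp p (fun _ : Fin n => 𝕜))‖ ≤ weakLpNorm 𝕜 p x :=
  le_ciSup (bddAbove_weakLpNorm p x) (⟨φ, by simpa using hφ⟩ : Metric.closedBall _ _)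

theorem weakLpNorm_nonneg (p : ℝ≥0∞) [Fact (1 ≤ p)] {n : ℕ} (x : Fin n → E) :
    0 ≤ weakLpNorm 𝕜 p x :=
  Real.iSup_nonneg fun _ => norm_nonneg _

theorem norm_le_mul_weakLpNorm (p : ℝ≥0∞) [Fact (1 ≤ p)] {n : ℕ} (x : Fin n → E)
    (φ : E →L[𝕜] 𝕜) :
    ‖(WithLp.toLp p (fun k => φ (x k)) : PiLp p (fun _ : Fin n => 𝕜))‖
      ≤ ‖φ‖ * weakLpNorm 𝕜 p x := by
  rcases eq_or_ne φ 0 with rfl | h0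
  · have : (WithLp.toLp p (fun k => (0 : E →L[𝕜] 𝕜) (x k)) : PiLp p (fun _ : Fin n => 𝕜)) = 0 := by
      ext; simp
    rw [this]
    simp
  · have hpos : 0 < ‖φ‖ := norm_pos_iff.2 h0
    have hψ : ‖((‖φ‖⁻¹ : ℝ) : 𝕜) • φ‖ ≤ 1 := by
      rw [norm_smul]; simp [hpos.ne']
    have key : (WithLp.toLp p (fun k => φ (x k)) : PiLp p (fun _ : Fin n => 𝕜))
        = ((‖φ‖ : ℝ) : 𝕜) • WithLp.toLp p (fun k => (((‖φ‖⁻¹ : ℝ) : 𝕜) • φ) (x k)) := by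
      ext k
      have : ((‖φ‖ : ℝ) : 𝕜) ≠ 0 := by exact_mod_cast hpos.ne'
      simp only [PiLp.smul_apply, _root_.smul_apply, smul_eq_mul,
        RCLike.ofReal_inv]
      rw [mul_inv_cancel_left₀ this]
    rw [key, norm_smul, RCLike.norm_ofReal, abs_of_pos hpos]
    exact mul_le_mul_of_nonneg_left (norm_le_weakLpNorm p x hψ) hpos.le

theorem norm_toLp_one {G : Type*} [NormedAddCommGroup G] {n : ℕ} (x : Fin n → G) :
    ‖(WithLp.toLp 1 x : PiLp 1 (fun _ : Fin n => G))‖ = ∑ k, ‖x k‖ := by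
  rw [PiLp.norm_eq_sum (by simp)]
  simp

theorem sum_norm_le_weakLpNorm_one {n : ℕ} (x : Fin n → E) {φ : E →L[𝕜] 𝕜} (hφ : ‖φ‖ ≤ 1) :
    ∑ k, ‖φ (x k)‖ ≤ weakLpNorm 𝕜 1 x := by
  have := norm_le_weakLpNorm 1 x hφ
  rwa [norm_toLp_one] at this

theorem weakLpNorm_one_le {n : ℕ} (x : Fin n → E) {w : ℝ}
    (h : ∀ φ : E →L[𝕜] 𝕜, ‖φ‖ ≤ 1 → ∑ k, ‖φ (x k)‖ ≤ w) : weakLpNorm 𝕜 1 x ≤ w := by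
  have : Nonempty (Metric.closedBall (0 : E →L[𝕜] 𝕜) 1) := ⟨⟨0, by simp⟩⟩
  refine ciSup_le fun φ => ?_
  rw [norm_toLp_one]
  exact h φ.1 (mem_closedBall_zero_iff.1 φ.2)

theorem norm_le_of_sum_norm_le {n : ℕ} (x : Fin n → E) {w : ℝ}
    (h : ∀ φ : E →L[𝕜] 𝕜, ‖φ‖ ≤ 1 → ∑ k, ‖φ (x k)‖ ≤ w) (i : Fin n) : ‖x i‖ ≤ w := by
  obtain ⟨φ, hφ, hx⟩ := exists_dual_vector'' 𝕜 (x i)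
  have h1 : ‖x i‖ = ‖φ (x i)‖ := by simp [hx]
  rw [h1]
  exact (Finset.single_le_sum (f := fun k => ‖φ (x k)‖) (fun k _ => norm_nonneg _)
    (Finset.mem_univ i)).trans (h φ hφ)

end WeakNorm

/-! ### The local form of the three properties -/

section LocalConcavity

/-- The operators `ℓ_∞ⁿ → F` of norm at most `w` are `r`-concave with constant `c * w`,
uniformly in `n`. The operator with `eᵢ ↦ xᵢ` is represented by the family `x`. -/
def LocallyConcave (𝕜 : Type*) [RCLike 𝕜] (F : Type*) [NormedAddCommGroup F] [NormedSpace 𝕜 F]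
    [NormedSpace ℝ F] (r c : ℝ) : Prop :=
  ∀ (n m : ℕ) (x : Fin n → F) (a : Fin n → Fin m → ℝ) (w : ℝ), 0 ≤ w →
    (∀ φ : F →L[𝕜] 𝕜, ‖φ‖ ≤ 1 → ∑ i, ‖φ (x i)‖ ≤ w) → (∀ i, ∑ k, |a i k| ^ r ≤ 1) →
    ∑ k, ‖∑ i, a i k • x i‖ ^ r ≤ (c * w) ^ r

variable {𝕜 : Type*} [RCLike 𝕜] {F : Type*} [NormedAddCommGroup F] [NormedSpace 𝕜 F]
  [NormedSpace ℝ F] {r c : ℝ}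

/-- Both sides scale with `w`. The case `w = 0` cannot be rescaled, but there all vectors vanish. -/
theorem LocallyConcave.of_unit [IsScalarTower ℝ 𝕜 F] (hr : 1 ≤ r) (hc : 0 ≤ c)
    (h : ∀ (n m : ℕ) (x : Fin n → F) (a : Fin n → Fin m → ℝ),
      (∀ φ : F →L[𝕜] 𝕜, ‖φ‖ ≤ 1 → ∑ i, ‖φ (x i)‖ ≤ 1) → (∀ i, ∑ k, |a i k| ^ r ≤ 1) →
      ∑ k, ‖∑ i, a i k • x i‖ ^ r ≤ c ^ r) : LocallyConcave 𝕜 F r c := by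
  intro n m x a w hw hx ha
  have hr0 : 0 < r := by linarith
  rcases hw.eq_or_lt with rfl | hw
  · have hx0 : ∀ i, x i = 0 := fun i => norm_le_zero_iff.1 (norm_le_of_sum_norm_le x hx i)
    simp [hx0, Real.zero_rpow hr0.ne']
  · have h1 := h n m (fun i => w⁻¹ • x i) a (fun φ hφ => ?_) ha
    · have h2 : ∀ k, ‖∑ i, a i k • w⁻¹ • x i‖ ^ r = (w⁻¹) ^ r * ‖∑ i, a i k • x i‖ ^ r := by
        intro k
        have : ∑ i, a i k • w⁻¹ • x i = w⁻¹ • ∑ i, a i k • x i := by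
          rw [Finset.smul_sum]
          exact Finset.sum_congr rfl fun i _ => smul_comm _ _ _
        rw [this, norm_smul, Real.mul_rpow (norm_nonneg _) (norm_nonneg _),
          Real.norm_of_nonneg (inv_nonneg.2 hw.le)]
      simp only [h2, ← Finset.mul_sum] at h1
      rw [Real.mul_rpow hc hw.le]
      rw [Real.inv_rpow hw.le, inv_mul_le_iff₀ (by positivity)] at h1
      linarith
    · have : ∀ i, ‖φ (w⁻¹ • x i)‖ = w⁻¹ * ‖φ (x i)‖ := fun i => by
        rw [← algebraMap_smul 𝕜 w⁻¹ (x i), map_smul, norm_smul, norm_algebraMap']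
        simp [abs_of_pos hw]
      simp only [this, ← Finset.mul_sum]
      rw [inv_mul_le_iff₀ hw, mul_one]
      exact hx φ hφ

theorem LocallyConcave.sum_fintype (h : LocallyConcave 𝕜 F r c) {n : ℕ} {κ : Type*} [Fintype κ]
    (x : Fin n → F) (a : Fin n → κ → ℝ) {w : ℝ} (hw : 0 ≤ w)
    (hx : ∀ φ : F →L[𝕜] 𝕜, ‖φ‖ ≤ 1 → ∑ i, ‖φ (x i)‖ ≤ w) (ha : ∀ i, ∑ k, |a i k| ^ r ≤ 1) :
    ∑ k, ‖∑ i, a i k • x i‖ ^ r ≤ (c * w) ^ r := by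
  let e := Fintype.equivFin κ
  have := h n _ x (fun i k => a i (e.symm k)) w hw hx (fun i => by
    rw [e.symm.sum_comp (fun k => |a i k| ^ r)]; exact ha i)
  rwa [e.symm.sum_comp (fun k => ‖∑ i, a i k • x i‖ ^ r)] at this

/-- The version with scalars in `𝕜`. -/
theorem LocallyConcave.sum_scalar [IsScalarTower ℝ 𝕜 F] (h : LocallyConcave 𝕜 F r c)
    (hr : 1 ≤ r) (hc : 0 ≤ c) {n : ℕ} {κ : Type*} [Fintype κ] (x : Fin n → F)
    (a : Fin n → κ → 𝕜) {w : ℝ} (hw : 0 ≤ w)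
    (hx : ∀ φ : F →L[𝕜] 𝕜, ‖φ‖ ≤ 1 → ∑ i, ‖φ (x i)‖ ≤ w) (ha : ∀ i, ∑ k, ‖a i k‖ ^ r ≤ 1) :
    ∑ k, ‖∑ i, a i k • x i‖ ^ r ≤ (2 * (c * w)) ^ r := by
  have hr0 : 0 ≤ r := by linarith
  have h1 := h.sum_fintype x (fun i k => RCLike.re (a i k)) hw hx fun i =>
    (Finset.sum_le_sum fun k _ => Real.rpow_le_rpow (abs_nonneg _)
      (RCLike.abs_re_le_norm _) hr0).trans (ha i)
  have h2 := h.sum_fintype x (fun i k => RCLike.im (a i k)) hw hx fun i =>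
    (Finset.sum_le_sum fun k _ => Real.rpow_le_rpow (abs_nonneg _)
      (RCLike.abs_im_le_norm _) hr0).trans (ha i)
  set A : κ → F := fun k => ∑ i, RCLike.re (a i k) • x i with hA
  set B : κ → F := fun k => ∑ i, RCLike.im (a i k) • x i with hB
  have hsplit : ∀ k, ∑ i, a i k • x i = A k + (RCLike.I : 𝕜) • B k := fun k => by
    rw [hA, hB]
    simp only [Finset.smul_sum, ← Finset.sum_add_distrib]
    refine Finset.sum_congr rfl fun i _ => ?_
    rw [← algebraMap_smul 𝕜 (RCLike.re (a i k)) (x i),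
      ← algebraMap_smul 𝕜 (RCLike.im (a i k)) (x i), smul_smul, ← add_smul]
    congr 1
    rw [mul_comm]
    exact (RCLike.re_add_im (a i k)).symm
  -- Convexity of `t ↦ t ^ r` costs `2 ^ (r - 1)`; the real and imaginary parts contribute another
  -- factor `2`, giving `2 ^ r` in total.
  have hpt : ∀ k, ‖∑ i, a i k • x i‖ ^ r ≤ 2 ^ (r - 1) * (‖A k‖ ^ r + ‖B k‖ ^ r) := fun k => by
    rw [hsplit k]
    have : ‖A k + (RCLike.I : 𝕜) • B k‖ ≤ ‖A k‖ + ‖B k‖ := by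
      refine (norm_add_le _ _).trans (add_le_add le_rfl ?_)
      rw [norm_smul]
      exact mul_le_of_le_one_left (norm_nonneg _) RCLike.norm_I_le_one
    refine (Real.rpow_le_rpow (norm_nonneg _) this hr0).trans ?_
    exact_mod_cast NNReal.rpow_add_le_mul_rpow_add_rpow ‖A k‖₊ ‖B k‖₊ hr
  calc ∑ k, ‖∑ i, a i k • x i‖ ^ r ≤ ∑ k, 2 ^ (r - 1) * (‖A k‖ ^ r + ‖B k‖ ^ r) :=
        Finset.sum_le_sum fun k _ => hpt k
    _ = 2 ^ (r - 1) * (∑ k, ‖A k‖ ^ r + ∑ k, ‖B k‖ ^ r) := by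
        rw [← Finset.mul_sum, Finset.sum_add_distrib]
    _ ≤ 2 ^ (r - 1) * ((c * w) ^ r + (c * w) ^ r) := by gcongr
    _ = (2 * (c * w)) ^ r := by
        rw [Real.mul_rpow (x := 2) (by norm_num) (by positivity), Real.rpow_sub_one (by norm_num)]
        ring

end LocalConcavity

/-! ### Duality of finite `ℓ_p`-spaces -/

/-- Hölder's inequality is sharp: the supremum over the dual unit ball is attained. -/
theorem exists_dual_weights {κ : Type*} [Fintype κ] {p q : ℝ} (hpq : p.HolderConjugate q)
    (v : κ → ℝ) (hv : ∀ k, 0 ≤ v k) :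
    ∃ b : κ → ℝ, (∀ k, 0 ≤ b k) ∧ ∑ k, b k ^ q ≤ 1 ∧
      ∑ k, b k * v k = (∑ k, v k ^ p) ^ (1 / p) := by
  lift v to κ → NNReal using hv
  obtain ⟨⟨g, hg, hgeq⟩, -⟩ := NNReal.isGreatest_Lp Finset.univ v hpq
  have hg : ∑ k, g k ^ q ≤ 1 := hg
  refine ⟨fun k => g k, fun k => (g k).2, ?_, ?_⟩
  · simpa using (NNReal.coe_le_coe.2 hg)
  · simpa [mul_comm] using congrArg (fun t : NNReal => (t : ℝ)) hgeq

/-! ### Homogeneous partitions of unity -/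

namespace homogFun

variable {m : ℕ} {r : ℝ}

theorem powerSum_apply (hr : 0 < r) (s : Fin m → ℝ) :
    (powerSum m hr).1 s = (∑ k, |s k| ^ r) ^ (1 / r) := rfl

theorem powerSum_nonneg (hr : 0 < r) (s : Fin m → ℝ) : 0 ≤ (powerSum m hr).1 s :=
  Real.rpow_nonneg (Finset.sum_nonneg fun _ _ => Real.rpow_nonneg (abs_nonneg _) _) _

theorem powerSum_rpow (hr : 0 < r) (s : Fin m → ℝ) :
    (powerSum m hr).1 s ^ r = ∑ k, |s k| ^ r := by
  rw [powerSum_apply, ← Real.rpow_mul (Finset.sum_nonneg fun _ _ =>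
    Real.rpow_nonneg (abs_nonneg _) _), one_div_mul_cancel hr.ne', Real.rpow_one]

theorem abs_le_powerSum (hr : 0 < r) (s : Fin m → ℝ) (k : Fin m) :
    |s k| ≤ (powerSum m hr).1 s := by
  rw [← Real.rpow_le_rpow_iff (abs_nonneg _) (powerSum_nonneg hr s) hr, powerSum_rpow]
  exact Finset.single_le_sum (f := fun k => |s k| ^ r)
    (fun _ _ => Real.rpow_nonneg (abs_nonneg _) _) (Finset.mem_univ k)

theorem norm_le_powerSum (hr : 0 < r) (s : Fin m → ℝ) : ‖s‖ ≤ (powerSum m hr).1 s :=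
  (pi_norm_le_iff_of_nonneg (powerSum_nonneg hr s)).2 fun k => abs_le_powerSum hr s k

theorem apply_zero (f : homogFun m) : f.1 0 = 0 := by
  simpa using f.2.2 0 le_rfl 0

theorem powerSum_pos (hr : 0 < r) {s : Fin m → ℝ} (hs : s ≠ 0) : 0 < (powerSum m hr).1 s :=
  (norm_pos_iff.2 hs).trans_le (norm_le_powerSum hr s)

theorem isCompact_powerSum_eq_one (hr : 0 < r) :
    IsCompact {s : Fin m → ℝ | (powerSum m hr).1 s = 1} := by
  refine Metric.isCompact_of_isClosed_isBounded
    (isClosed_eq (powerSum m hr).2.1 continuous_const) ?_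
  refine (Metric.isBounded_closedBall (x := (0 : Fin m → ℝ)) (r := 1)).subset fun s hs => ?_
  rw [mem_closedBall_zero_iff]
  exact (norm_le_powerSum hr s).trans_eq hs

/-- The product of the `r`-norm with a bounded function which is homogeneous of degree zero
and continuous away from the origin. -/
noncomputable def powerSumMul (hr : 0 < r) (q : (Fin m → ℝ) → ℝ) (hq0 : ∀ s, 0 ≤ q s)
    (hq1 : ∀ s, q s ≤ 1)
    (hqc : ∀ s, s ≠ 0 → ContinuousAt q s) (hqh : ∀ c : ℝ, 0 < c → ∀ s, q (c • s) = q s) :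
    homogFun m :=
  ⟨fun s => (powerSum m hr).1 s * q s, by
    refine ⟨continuous_iff_continuousAt.2 fun s => ?_, fun c hc s => ?_⟩
    -- At the origin `q` may be discontinuous, but it is bounded and the `r`-norm tends to zero.
    · by_cases hs : s = 0
      · subst hs
        have h0 : Tendsto (powerSum m hr).1 (𝓝 0) (𝓝 0) := by
          simpa [apply_zero] using (powerSum m hr).2.1.tendsto 0
        have : Tendsto (fun s => (powerSum m hr).1 s * q s) (𝓝 0) (𝓝 0) :=
          squeeze_zero (fun s => mul_nonneg (powerSum_nonneg hr s) (hq0 s))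
            (fun s => mul_le_of_le_one_right (powerSum_nonneg hr s) (hq1 s)) h0
        simpa [ContinuousAt, apply_zero] using this
      · exact (powerSum m hr).2.1.continuousAt.mul (hqc s hs)
    · rcases hc.eq_or_lt with rfl | hc
      · simp [apply_zero]
      · simp only [hqh c hc s, (powerSum m hr).2.2 c hc.le s, mul_assoc]⟩

/-- The points `t i` form an `ε`-net of the compact unit sphere of the `r`-norm. Bump functions
around them, extended by homogeneity and normalized, average only those multiples of `t i` that lie
close to `s`. -/
theorem exists_partition (hr : 0 < r) {ε : ℝ} (hε : 0 < ε) :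
    ∃ (n : ℕ) (t : Fin n → Fin m → ℝ) (h : Fin n → homogFun m),
      (∀ i, ∑ k, |t i k| ^ r ≤ 1) ∧ (∀ i s, 0 ≤ (h i).1 s) ∧
      (∀ s, ∑ i, (h i).1 s = (powerSum m hr).1 s) ∧
      ∀ k s, |s k - ∑ i, t i k * (h i).1 s| ≤ ε * (powerSum m hr).1 s := by
  obtain ⟨K, hK, hKfin, hcover⟩ := (isCompact_powerSum_eq_one (m := m) hr).finite_cover_balls hε
  let e := hKfin.toFinset.equivFin.symm
  set n := hKfin.toFinset.card
  let t : Fin n → Fin m → ℝ := fun i => (e i).1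
  set p := (powerSum m hr).1 with hp
  have ht : ∀ i, p (t i) = 1 := fun i => hK (hKfin.mem_toFinset.1 (e i).2)
  -- The bump is nonzero only if `s` lies within `ε * p s` of `p s • t i`; this condition is
  -- invariant under positive dilations.
  let g : Fin n → (Fin m → ℝ) → ℝ := fun i s => 0 ⊔ (ε * p s - ‖s - p s • t i‖)
  let G : (Fin m → ℝ) → ℝ := fun s => ∑ i, g i s
  have hpc : Continuous p := (powerSum m hr).2.1
  have hgc : ∀ i, Continuous (g i) := fun i => by
    refine continuous_const.sup ((continuous_const.mul hpc).sub ?_)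
    exact (continuous_id.sub (hpc.smul continuous_const)).norm
  have hg0 : ∀ i s, 0 ≤ g i s := fun i s => le_max_left _ _
  have hgh : ∀ i (c : ℝ), 0 ≤ c → ∀ s, g i (c • s) = c * g i s := fun i c hc s => by
    have h1 : p (c • s) = c * p s := (powerSum m hr).2.2 c hc s
    have h2 : c • s - (c * p s) • t i = c • (s - p s • t i) := by rw [smul_sub, smul_smul]
    simp only [g, h1, h2, norm_smul, Real.norm_of_nonneg hc]
    rw [mul_max_of_nonneg _ _ hc]
    congr 1 <;> ring
  have hG0 : ∀ s, 0 ≤ G s := fun s => Finset.sum_nonneg fun i _ => hg0 i s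
  have hGpos : ∀ s, s ≠ 0 → 0 < G s := fun s hs => by
    have hps : 0 < p s := powerSum_pos hr hs
    have hmem : (p s)⁻¹ • s ∈ {s : Fin m → ℝ | (powerSum m hr).1 s = 1} := by
      change p ((p s)⁻¹ • s) = 1
      rw [hp, (powerSum m hr).2.2 _ (inv_nonneg.2 hps.le) s]
      exact inv_mul_cancel₀ hps.ne'
    obtain ⟨u, hu, hdist⟩ := Set.mem_iUnion₂.1 (hcover hmem)
    obtain ⟨i, hi⟩ : ∃ i, t i = u :=
      ⟨e.symm ⟨u, hKfin.mem_toFinset.2 hu⟩, by simp [t]⟩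
    have hgi : 0 < g i s := by
      refine lt_max_of_lt_right (sub_pos.2 ?_)
      have : s - p s • t i = p s • ((p s)⁻¹ • s - u) := by
        rw [smul_sub, smul_smul, mul_inv_cancel₀ hps.ne', one_smul, hi]
      rw [this, norm_smul, Real.norm_of_nonneg hps.le, mul_comm]
      exact mul_lt_mul_of_pos_right (by rwa [Metric.mem_ball, dist_eq_norm] at hdist) hps
    exact hgi.trans_le (Finset.single_le_sum (f := fun i => g i s) (fun i _ => hg0 i s)
      (Finset.mem_univ i))
  have hsum : ∀ s, s ≠ 0 → ∑ i, g i s / G s = 1 := fun s hs => by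
    rw [← Finset.sum_div]; exact div_self (hGpos s hs).ne'
  refine ⟨n, t, fun i => powerSumMul hr (fun s => g i s / G s)
    (fun s => div_nonneg (hg0 i s) (hG0 s)) (fun s => ?_) (fun s hs => ?_) (fun c hc s => ?_),
    fun i => ?_, fun i s => ?_, fun s => ?_, fun k s => ?_⟩
  · exact div_le_one_of_le₀ (Finset.single_le_sum (f := fun i => g i s) (fun i _ => hg0 i s)
      (Finset.mem_univ i)) (hG0 s)
  · exact (hgc i).continuousAt.div (continuous_finsetSum _ fun i _ => hgc i).continuousAt
      (hGpos s hs).ne'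
  · simp only [G, hgh _ c hc.le, ← Finset.mul_sum]
    exact mul_div_mul_left _ _ hc.ne'
  · rw [← powerSum_rpow hr (t i), ← hp, ht i, Real.one_rpow]
  · exact mul_nonneg (powerSum_nonneg hr s) (div_nonneg (hg0 i s) (hG0 s))
  · change ∑ i, p s * (g i s / G s) = p s
    rw [← Finset.mul_sum]
    by_cases hs : s = 0
    · subst hs; simp [hp, apply_zero]
    · rw [hsum s hs, mul_one]
  · change |s k - ∑ i, t i k * (p s * (g i s / G s))| ≤ ε * p s
    by_cases hs : s = 0
    · subst hs; simp [hp, apply_zero]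
    · have h1 : s k - ∑ i, t i k * (p s * (g i s / G s))
          = ∑ i, g i s / G s * (s k - p s * t i k) := by
        simp only [mul_sub, Finset.sum_sub_distrib, ← Finset.sum_mul, hsum s hs, one_mul]
        congr 1
        exact Finset.sum_congr rfl fun i _ => by ring
      have h2 : ∀ i, |g i s / G s * (s k - p s * t i k)| ≤ g i s / G s * (ε * p s) := fun i => by
        rw [abs_mul, abs_of_nonneg (div_nonneg (hg0 i s) (hG0 s))]
        rcases (hg0 i s).eq_or_lt with h | h
        · rw [← h]; simp
        · refine mul_le_mul_of_nonneg_left ?_ (div_nonneg (hg0 i s) (hG0 s))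
          have h3 : 0 < ε * p s - ‖s - p s • t i‖ := by
            rcases lt_max_iff.1 h with h | h
            · exact absurd h (lt_irrefl _)
            · exact h
          have h4 : |s k - p s * t i k| ≤ ‖s - p s • t i‖ := by
            simpa using norm_le_pi_norm (s - p s • t i) k
          linarith
      rw [h1]
      refine (Finset.abs_sum_le_sum_abs _ _).trans ((Finset.sum_le_sum fun i _ => h2 i).trans ?_)
      rw [← Finset.sum_mul, hsum s hs, one_mul]

end homogFun

/-! ### From local concavity to the functional calculus -/

/-- A linear map on the homogeneous functions which is bounded on the order interval of the
`r`-norm maps the coordinate functions to an `r`-summable family. -/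
theorem LocallyConcave.sum_coord {𝕜 : Type*} [RCLike 𝕜] {F : Type*} [NormedAddCommGroup F]
    [NormedSpace 𝕜 F] [NormedSpace ℝ F] [IsScalarTower ℝ 𝕜 F] {r c : ℝ}
    (h : LocallyConcave 𝕜 F r c) (hr : 0 < r) {m : ℕ} (D : homogFun m →ₗ[ℝ] F)
    {B : ℝ} (hB : 0 ≤ B)
    (hD : ∀ f : homogFun m, (∀ s, |f.1 s| ≤ (homogFun.powerSum m hr).1 s) → ‖D f‖ ≤ B) :
    ∑ k, ‖D (homogFun.coord k)‖ ^ r ≤ (c * (2 * B)) ^ r := by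
  have key : ∀ ε : ℝ, 0 < ε → ∃ v : Fin m → F, (∑ k, ‖v k‖ ^ r ≤ (c * (2 * B)) ^ r) ∧
      ∀ k, ‖v k - D (homogFun.coord k)‖ ≤ ε * B := by
    intro ε hε
    obtain ⟨n, t, g, ht, hg0, hgsum, hgapprox⟩ := homogFun.exists_partition (m := m) hr hε
    -- Since the `g i` are positive with sum the `r`-norm, every signed combination stays in its
    -- order interval. This is the estimate that makes `eᵢ ↦ D (g i)` a bounded operator on `ℓ_∞ⁿ`.
    have hsigned : ∀ σ : Fin n → ℝ, (∀ i, |σ i| ≤ 1) → ‖D (∑ i, σ i • g i)‖ ≤ B := by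
      intro σ hσ
      refine hD _ fun s => ?_
      have : (∑ i, σ i • g i).1 s = ∑ i, σ i * (g i).1 s := by
        simp [Finset.sum_apply]
      rw [this, ← hgsum s]
      refine (Finset.abs_sum_le_sum_abs _ _).trans (Finset.sum_le_sum fun i _ => ?_)
      rw [abs_mul, abs_of_nonneg (hg0 i s)]
      exact mul_le_of_le_one_left (hg0 i s) (hσ i)
    have hreal : ∀ L : F →ₗ[ℝ] ℝ, (∀ z, |L z| ≤ ‖z‖) → ∑ i, |L (D (g i))| ≤ B := by
      intro L hL
      have h1 : ∑ i, |L (D (g i))| = L (D (∑ i, (SignType.sign (L (D (g i))) : ℝ) • g i)) := by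
        simp only [map_sum, map_smul, smul_eq_mul]
        exact Finset.sum_congr rfl fun i _ => (sign_mul_self _).symm
      rw [h1]
      refine (le_abs_self _).trans ((hL _).trans (hsigned _ fun i => ?_))
      rcases lt_trichotomy (L (D (g i))) 0 with h | h | h <;> simp [h]
    -- The weak bound is `2 * B` because real and imaginary parts of a functional are each bounded
    -- by `B`.
    refine ⟨fun k => ∑ i, t i k • D (g i), h n m _ t (2 * B) (by positivity) (fun φ hφ => ?_) ht,
      fun k => ?_⟩
    · let ψ : F →ₗ[ℝ] 𝕜 := φ.toLinearMap.restrictScalars ℝ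
      have hψ : ∀ z, ‖ψ z‖ ≤ ‖z‖ := fun z =>
        (φ.le_opNorm z).trans (mul_le_of_le_one_left (norm_nonneg _) hφ)
      have hre := hreal ((RCLike.reLm (K := 𝕜)).comp ψ) fun z =>
        (RCLike.abs_re_le_norm _).trans (hψ z)
      have him := hreal ((RCLike.imLm (K := 𝕜)).comp ψ) fun z =>
        (RCLike.abs_im_le_norm _).trans (hψ z)
      calc ∑ i, ‖φ (D (g i))‖
          ≤ ∑ i, (|RCLike.re (φ (D (g i)))| + |RCLike.im (φ (D (g i)))|) :=
            Finset.sum_le_sum fun i _ => RCLike.norm_le_abs_re_add_abs_im _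
        _ ≤ 2 * B := by
            rw [Finset.sum_add_distrib, two_mul]
            exact add_le_add hre him
    -- The approximation error is `ε` times an element of the order interval, so `D` maps it to norm
    -- at most `ε * B`.
    · have h1 : ∑ i, t i k • D (g i) - D (homogFun.coord k)
          = ε • D (ε⁻¹ • (∑ i, t i k • g i - homogFun.coord k)) := by
        rw [map_smul, smul_smul, mul_inv_cancel₀ hε.ne', one_smul, map_sub, map_sum]
        simp
      rw [h1, norm_smul, Real.norm_of_nonneg hε.le]
      refine mul_le_mul_of_nonneg_left (hD _ fun s => ?_) hε.le
      have h2 : (ε⁻¹ • (∑ i, t i k • g i - homogFun.coord k)).1 s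
          = ε⁻¹ * (∑ i, t i k * (g i).1 s - s k) := by
        simp [Finset.sum_apply, homogFun.coord]
      rw [h2, abs_mul, abs_of_pos (inv_pos.2 hε), inv_mul_le_iff₀ hε, abs_sub_comm]
      exact hgapprox k s
  -- The bound on the approximants does not depend on `ε` (nor on the size of the partition), so it
  -- survives the limit `ε → 0`.
  choose v hv1 hv2 using fun j : ℕ => key (1 / ((j : ℝ) + 1)) Nat.one_div_pos_of_nat
  have hlim : ∀ k, Tendsto (fun j => v j k) atTop (𝓝 (D (homogFun.coord k))) := fun k => by
    rw [tendsto_iff_norm_sub_tendsto_zero]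
    refine squeeze_zero (fun _ => norm_nonneg _) (fun j => hv2 j k) ?_
    simpa using tendsto_one_div_add_atTop_nhds_zero_nat.mul_const B
  have hsum_lim : Tendsto (fun j => ∑ k, ‖v j k‖ ^ r) atTop
      (𝓝 (∑ k, ‖D (homogFun.coord k)‖ ^ r)) :=
    tendsto_finsetSum _ fun k _ => (hlim k).norm.rpow_const (Or.inr hr.le)
  exact le_of_tendsto' hsum_lim hv1

/-! ### Operators on Banach lattices -/

/-- A lattice homomorphism `τ` is monotone, so it maps the order interval of the `r`-norm into that
of `τ p`, where the solid norm is at most `‖τ p‖`. Hence `LocallyConcave.sum_coord` applies to `T ∘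
τ`. -/
theorem LocallyConcave.isConcaveOperator {𝕜 : Type*} [RCLike 𝕜] {F : Type*}
    [NormedAddCommGroup F] [NormedSpace 𝕜 F] [NormedSpace ℝ F] [IsScalarTower ℝ 𝕜 F] {r c : ℝ}
    (h : LocallyConcave 𝕜 F r c) (hc : 0 ≤ c) (hr : 0 < r) {X : Type*} [NormedAddCommGroup X]
    [NormedSpace ℝ X] [Lattice X] [IsOrderedAddMonoid X] [HasSolidNorm X] (T : X →L[ℝ] F) :
    IsConcaveOperator hr T := by
  refine ⟨c * (2 * ‖T‖), by positivity, ?_⟩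
  rintro n x y ⟨τ, hmax, hcoord, rfl⟩
  set p := homogFun.powerSum n hr
  have hmono : ∀ f g : homogFun n, (∀ s, f.1 s ≤ g.1 s) → τ f ≤ τ g := fun f g hfg => by
    have : homogFun.max f g = g := Subtype.ext (funext fun s => sup_eq_right.2 (hfg s))
    rw [← this, hmax]
    exact le_sup_left
  have hD : ∀ f : homogFun n, (∀ s, |f.1 s| ≤ p.1 s) →
      ‖(T.toLinearMap.comp τ) f‖ ≤ ‖T‖ * ‖τ p‖ := fun f hf => by
    refine (T.le_opNorm _).trans (mul_le_mul_of_nonneg_left ?_ (norm_nonneg _))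
    refine norm_le_norm_of_abs_le_abs (le_trans ?_ (le_abs_self _))
    refine sup_le (hmono _ _ fun s => (le_abs_self _).trans (hf s)) ?_
    rw [← map_neg]
    exact hmono _ _ fun s => (neg_le_abs _).trans (hf s)
  have key := h.sum_coord hr (T.toLinearMap.comp τ) (by positivity) hD
  simp only [LinearMap.comp_apply, hcoord, ContinuousLinearMap.coe_coe] at key
  refine (Real.rpow_le_rpow (Finset.sum_nonneg fun _ _ => Real.rpow_nonneg (norm_nonneg _) _) key
    (by positivity)).trans_eq ?_
  rw [← Real.rpow_mul (by positivity), mul_one_div_cancel hr.ne', Real.rpow_one]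
  ring

/-! ### Positive functionals between a superadditive and a subadditive function -/

/-- Read `pos` as the positive cone. The infimum `N u` of `∑ β(l') - ∑ α(l)` over all `l, l'` with
`u ≤ ∑ j(l') - ∑ j(l)` is sublinear. The hypothesis `hle` says that it is nonnegative at zero, which
by subadditivity also keeps it finite. A linear `φ ≤ N` has all the required properties: evaluate at
`-u` for positivity, at `j i` and `-(j i)` for the two bounds. -/
theorem exists_positive_functional_between {V ι : Type*} [AddCommGroup V] [Module ℝ V]
    (pos : V → Prop) (pos_zero : pos 0) (pos_add : ∀ u v, pos u → pos v → pos (u + v))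
    (pos_smul : ∀ c : ℝ, 0 < c → ∀ u, pos u → pos (c • u))
    (j : ι → V) (α β : ι → ℝ) (exists_pos : ∀ u, ∃ i, pos (j i - u))
    (exists_smul : ∀ c : ℝ, 0 < c → ∀ i, ∃ i', j i' = c • j i ∧ α i' = c * α i ∧ β i' = c * β i)
    (hle : ∀ l l' : List ι, pos ((l'.map j).sum - (l.map j).sum) →
      (l.map α).sum ≤ (l'.map β).sum) :
    ∃ φ : V →ₗ[ℝ] ℝ, (∀ u, pos u → 0 ≤ φ u) ∧ ∀ i, α i ≤ φ (j i) ∧ φ (j i) ≤ β i := by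
  let S : V → Set ℝ := fun u => {t | ∃ l l' : List ι,
    pos ((l'.map j).sum - (l.map j).sum - u) ∧ t = (l'.map β).sum - (l.map α).sum}
  have hadd : ∀ u v s t, s ∈ S u → t ∈ S v → s + t ∈ S (u + v) := by
    rintro u v _ _ ⟨l₁, l₁', h₁, rfl⟩ ⟨l₂, l₂', h₂, rfl⟩
    refine ⟨l₁ ++ l₂, l₁' ++ l₂', ?_, ?_⟩
    · convert pos_add _ _ h₁ h₂ using 1
      simp only [List.map_append, List.sum_append]
      abel
    · simp only [List.map_append, List.sum_append]
      ring
  have hnonempty : ∀ u, (S u).Nonempty := fun u => by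
    obtain ⟨i, hi⟩ := exists_pos u
    exact ⟨_, [], [i], by simpa using hi, rfl⟩
  have hzero : ∀ t ∈ S 0, 0 ≤ t := by
    rintro _ ⟨l, l', h, rfl⟩
    exact sub_nonneg.2 (hle l l' (by simpa using h))
  have hbdd : ∀ u, BddBelow (S u) := fun u => by
    obtain ⟨t₀, ht₀⟩ := hnonempty (-u)
    refine ⟨-t₀, fun t ht => ?_⟩
    have := hzero (t + t₀) (by simpa using hadd u (-u) t t₀ ht ht₀)
    linarith
  let N : V → ℝ := fun u => sInf (S u)
  have hNadd : ∀ u v, N (u + v) ≤ N u + N v := fun u v => by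
    have h1 : ∀ s ∈ S u, N (u + v) - s ≤ N v := fun s hs =>
      le_csInf (hnonempty v) fun t ht => by
        have : N (u + v) ≤ s + t := csInf_le (hbdd _) (hadd u v s t hs ht)
        linarith
    have h2 : N (u + v) - N v ≤ N u := le_csInf (hnonempty u) fun s hs => by
      have := h1 s hs
      linarith
    linarith
  have hSsmul : ∀ c : ℝ, 0 < c → ∀ u, ∀ t ∈ S u, c * t ∈ S (c • u) := by
    rintro c hc u _ ⟨l, l', h, rfl⟩
    choose σ hσj hσα hσβ using exists_smul c hc
    refine ⟨l.map σ, l'.map σ, ?_, ?_⟩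
    · convert pos_smul c hc _ h using 1
      simp [Function.comp_def, hσj, smul_sub, List.smul_sum]
    · simp [Function.comp_def, hσα, hσβ, mul_sub, List.sum_map_mul_left]
  have hNsmul_le : ∀ c : ℝ, 0 < c → ∀ u, N (c • u) ≤ c * N u := fun c hc u => by
    rw [← div_le_iff₀' hc]
    refine le_csInf (hnonempty u) fun t ht => ?_
    rw [div_le_iff₀' hc]
    exact csInf_le (hbdd _) (hSsmul c hc u t ht)
  have hNsmul : ∀ c : ℝ, 0 < c → ∀ u, N (c • u) = c * N u := fun c hc u => by
    refine le_antisymm (hNsmul_le c hc u) ?_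
    have := hNsmul_le c⁻¹ (inv_pos.2 hc) (c • u)
    rw [smul_smul, inv_mul_cancel₀ hc.ne', one_smul] at this
    rwa [← le_inv_mul_iff₀ hc]
  have hN0 : 0 ≤ N 0 := le_csInf (hnonempty 0) hzero
  -- Hahn–Banach from the zero subspace, where only `0 ≤ N 0` has to be checked.
  obtain ⟨φ, -, hφ⟩ := exists_extension_of_le_sublinear (⟨⊥, 0⟩ : V →ₗ.[ℝ] ℝ) N hNsmul hNadd
    (by
      rintro ⟨x, hx⟩
      have hx0 : x = 0 := by simpa using hx
      subst hx0
      simpa using hN0)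
  have hφS : ∀ u, ∀ t ∈ S u, φ u ≤ t := fun u t ht => (hφ u).trans (csInf_le (hbdd u) ht)
  refine ⟨φ, fun u hu => ?_, fun i => ⟨?_, ?_⟩⟩
  · have := hφS (-u) 0 ⟨[], [], by simpa using hu, by simp⟩
    simpa using this
  · have := hφS (-(j i)) (-(α i)) ⟨[i], [], by simpa using pos_zero, by simp⟩
    simpa using this
  · exact hφS (j i) (β i) ⟨[], [i], by simpa using pos_zero, by simp⟩

/-! ### Operators on quasi Banach function spaces -/

/-- Compactness of the unit sphere and homogeneity. The bound is what makes `h(x₁, …, xₘ)` belong to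
a solid space containing the `xₖ`. -/
theorem homogFun.exists_bound {m : ℕ} (f : homogFun m) :
    ∃ M : ℝ, 0 ≤ M ∧ ∀ s, |f.1 s| ≤ M * ∑ k, |s k| := by
  obtain ⟨M, hM⟩ := (isCompact_sphere (0 : Fin m → ℝ) 1).exists_bound_of_continuousOn
    f.2.1.continuousOn
  refine ⟨|M|, abs_nonneg _, fun s => ?_⟩
  have hs : ‖s‖ ≤ ∑ k, |s k| := by
    refine (pi_norm_le_iff_of_nonneg (Finset.sum_nonneg fun _ _ => abs_nonneg _)).2 fun k => ?_
    exact Finset.single_le_sum (f := fun k => |s k|) (fun _ _ => abs_nonneg _) (Finset.mem_univ k)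
  refine le_trans ?_ (mul_le_mul_of_nonneg_left hs (abs_nonneg _))
  by_cases h0 : s = 0
  · subst h0; simp [homogFun.apply_zero]
  · have hpos : 0 < ‖s‖ := norm_pos_iff.2 h0
    have h1 : s = ‖s‖ • (‖s‖⁻¹ • s) := by rw [smul_smul, mul_inv_cancel₀ hpos.ne', one_smul]
    have h2 : |f.1 (‖s‖⁻¹ • s)| ≤ |M| :=
      (hM _ (by simp [norm_smul, hpos.ne'])).trans (le_abs_self _)
    rw [h1, f.2.2 _ hpos.le, abs_mul, abs_of_pos hpos, ← h1, mul_comm]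
    exact mul_le_mul_of_nonneg_right h2 hpos.le

section FunctionSpaces

variable {Ω : Type*} [MeasurableSpace Ω] {μ : Measure Ω}

instance : IsOrderedAddMonoid (Ω →ₘ[μ] ℝ) where
  add_le_add_left x y h z := by
    rw [← AEEqFun.coeFn_le] at h ⊢
    filter_upwards [h, AEEqFun.coeFn_add x z, AEEqFun.coeFn_add y z] with ω h1 h2 h3
    rw [h2, h3]
    exact add_le_add_left h1 _

namespace homogFun

/-- The function `ω ↦ f(x₁(ω), …, xₘ(ω))`. -/
noncomputable def compAEEqFun {m : ℕ} (x : Fin m → Ω →ₘ[μ] ℝ) : homogFun m →ₗ[ℝ] (Ω →ₘ[μ] ℝ) where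
  toFun f := AEEqFun.mk (fun ω => f.1 fun k => x k ω) (f.2.1.comp_aestronglyMeasurable
    (aemeasurable_pi_lambda _ fun k => (x k).aemeasurable).aestronglyMeasurable)
  map_add' _ _ := rfl
  map_smul' _ _ := rfl

theorem coeFn_compAEEqFun {m : ℕ} (x : Fin m → Ω →ₘ[μ] ℝ) (f : homogFun m) :
    ∀ᵐ ω ∂μ, compAEEqFun x f ω = f.1 fun k => x k ω :=
  AEEqFun.coeFn_mk _ _

theorem compAEEqFun_coord {m : ℕ} (x : Fin m → Ω →ₘ[μ] ℝ) (k : Fin m) :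
    compAEEqFun x (coord k) = x k :=
  AEEqFun.ext (coeFn_compAEEqFun x (coord k))

end homogFun

theorem coeFn_sum_absPow {m : ℕ} (r : ℝ) (x : Fin m → Ω →ₘ[μ] ℝ) :
    ∀ᵐ ω ∂μ, (∑ k, absPow r (x k)) ω = ∑ k, |x k ω| ^ r := by
  filter_upwards [AEEqFun.coeFn_finsetSum Finset.univ fun k => absPow r (x k),
    ae_all_iff.2 fun k => coeFn_absPow r (x k)] with ω h1 h2
  rw [h1, Finset.sum_apply]
  exact Finset.sum_congr rfl fun k _ => h2 k

/-- Identifies the functional calculus with the pointwise expression in the definition of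
`r`-convexity. -/
theorem homogFun.compAEEqFun_powerSum {m : ℕ} {r : ℝ} (hr : 0 < r) (x : Fin m → Ω →ₘ[μ] ℝ) :
    homogFun.compAEEqFun x (homogFun.powerSum m hr) = absPow (1 / r) (∑ k, absPow r (x k)) := by
  apply AEEqFun.ext
  filter_upwards [homogFun.coeFn_compAEEqFun x (homogFun.powerSum m hr),
    coeFn_absPow (1 / r) (∑ k, absPow r (x k)), coeFn_sum_absPow r x] with ω h1 h2 h3
  rw [h1, h2, h3, homogFun.powerSum_apply, abs_of_nonneg]
  exact Finset.sum_nonneg fun _ _ => Real.rpow_nonneg (abs_nonneg _) _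

theorem absPow_abs_le_absPow_abs {t : ℝ} (ht : 0 ≤ t) {x y : Ω →ₘ[μ] ℝ}
    (h : |x| ≤ |y|) : |absPow t x| ≤ |absPow t y| := by
  rw [← AEEqFun.coeFn_le] at h ⊢
  filter_upwards [h, AEEqFun.coeFn_abs x, AEEqFun.coeFn_abs y, AEEqFun.coeFn_abs (absPow t x),
    AEEqFun.coeFn_abs (absPow t y), coeFn_absPow t x, coeFn_absPow t y] with ω h h1 h2 h3 h4 h5 h6
  rw [h1, h2] at h
  rw [h3, h4, h5, h6, abs_of_nonneg (Real.rpow_nonneg (abs_nonneg _) _),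
    abs_of_nonneg (Real.rpow_nonneg (abs_nonneg _) _)]
  exact Real.rpow_le_rpow (abs_nonneg _) h ht

theorem absPow_nonneg (t : ℝ) (x : Ω →ₘ[μ] ℝ) : 0 ≤ absPow t x := by
  rw [← AEEqFun.coeFn_le]
  filter_upwards [coeFn_absPow t x, AEEqFun.coeFn_zero (α := Ω) (β := ℝ) (μ := μ)] with ω h1 h2
  rw [h1, h2]
  exact Real.rpow_nonneg (abs_nonneg _) _

theorem absPow_smul (t : ℝ) (a : ℝ) (x : Ω →ₘ[μ] ℝ) :
    absPow t (a • x) = |a| ^ t • absPow t x := by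
  apply AEEqFun.ext
  filter_upwards [coeFn_absPow t (a • x), AEEqFun.coeFn_smul a x,
    AEEqFun.coeFn_smul (|a| ^ t) (absPow t x), coeFn_absPow t x] with ω h1 h2 h3 h4
  rw [h1, h2, h3, Pi.smul_apply, Pi.smul_apply, h4, smul_eq_mul, smul_eq_mul, abs_mul,
    Real.mul_rpow (abs_nonneg _) (abs_nonneg _)]

theorem absPow_absPow_inv {r : ℝ} (hr : 0 < r) (x : Ω →ₘ[μ] ℝ) :
    absPow r (absPow (1 / r) x) = |x| := by
  apply AEEqFun.ext
  filter_upwards [coeFn_absPow r (absPow (1 / r) x), coeFn_absPow (1 / r) x,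
    AEEqFun.coeFn_abs x] with ω h1 h2 h3
  rw [h1, h2, h3, abs_of_nonneg (Real.rpow_nonneg (abs_nonneg _) _),
    ← Real.rpow_mul (abs_nonneg _), one_div_mul_cancel hr.ne', Real.rpow_one]

namespace QuasiKotheSpace

variable (X : QuasiKotheSpace μ)

theorem compAEEqFun_mem {m : ℕ} (x : Fin m → X.carrier) (f : homogFun m) :
    homogFun.compAEEqFun (fun k => (x k).1) f ∈ X.carrier := by
  obtain ⟨M, hM0, hM⟩ := homogFun.exists_bound f
  have habs : ∀ k, |(x k).1| ∈ X.carrier := fun k =>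
    (X.solid _ _ (x k).2 (abs_abs _).le).1
  have hmem : M • ∑ k, |(x k).1| ∈ X.carrier :=
    X.carrier.smul_mem _ (X.carrier.sum_mem fun k _ => habs k)
  refine (X.solid _ _ hmem ?_).1
  rw [← AEEqFun.coeFn_le]
  filter_upwards [AEEqFun.coeFn_abs (homogFun.compAEEqFun (fun k => (x k).1) f),
    homogFun.coeFn_compAEEqFun (fun k => (x k).1) f, AEEqFun.coeFn_abs (M • ∑ k, |(x k).1|),
    AEEqFun.coeFn_smul M (∑ k, |(x k).1|),
    AEEqFun.coeFn_finsetSum Finset.univ fun k => |(x k).1|,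
    ae_all_iff.2 fun k => AEEqFun.coeFn_abs (x k).1] with ω h1 h2 h3 h4 h5 h6
  rw [h1, h2, h3, h4, Pi.smul_apply, h5, Finset.sum_apply, smul_eq_mul]
  simp only [h6]
  exact (hM _).trans (le_abs_self _)

theorem absPow_sum_absPow_mem {m : ℕ} {r : ℝ} (hr : 0 < r) (x : Fin m → X.carrier) :
    absPow (1 / r) (∑ k, absPow r (x k).1) ∈ X.carrier := by
  rw [← homogFun.compAEEqFun_powerSum hr]
  exact X.compAEEqFun_mem x _

/-- The argument for Banach lattices, with pointwise composition as the lattice homomorphism;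
solidity of the quasi norm is enough, the triangle inequality plays no role. -/
theorem _root_.LocallyConcave.sum_norm_rpow_le {𝕜 : Type*} [RCLike 𝕜] {F : Type*}
    [NormedAddCommGroup F] [NormedSpace 𝕜 F] [NormedSpace ℝ F] [IsScalarTower ℝ 𝕜 F] {r c : ℝ}
    (h : LocallyConcave 𝕜 F r c) (hr : 0 < r) (X : QuasiKotheSpace μ) (T : X.carrier →ₗ[ℝ] F)
    {C : ℝ} (hC : 0 ≤ C) (hT : ∀ x : X.carrier, ‖T x‖ ≤ C * X.qnorm x)
    {m : ℕ} (x : Fin m → X.carrier) :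
    ∑ k, ‖T (x k)‖ ^ r ≤
      (c * (2 * (C * X.qnorm (absPow (1 / r) (∑ k, absPow r (x k).1))))) ^ r := by
  let τ : homogFun m →ₗ[ℝ] X.carrier :=
    (homogFun.compAEEqFun fun k => (x k).1).codRestrict X.carrier (X.compAEEqFun_mem x)
  have hcoord : ∀ k, τ (homogFun.coord k) = x k := fun k =>
    Subtype.ext (homogFun.compAEEqFun_coord _ k)
  have hmem := X.absPow_sum_absPow_mem hr x
  have key := h.sum_coord hr (T.comp τ) (mul_nonneg hC (X.qnorm_nonneg _ hmem)) fun f hf => ?_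
  · simpa only [LinearMap.comp_apply, hcoord] using key
  · refine (hT _).trans (mul_le_mul_of_nonneg_left (X.solid _ _ hmem ?_).2 hC)
    rw [← homogFun.compAEEqFun_powerSum hr, ← AEEqFun.coeFn_le]
    have hval : (τ f).1 = homogFun.compAEEqFun (fun k => (x k).1) f := rfl
    rw [hval]
    filter_upwards [AEEqFun.coeFn_abs (homogFun.compAEEqFun (fun k => (x k).1) f),
      homogFun.coeFn_compAEEqFun (fun k => (x k).1) f,
      AEEqFun.coeFn_abs (homogFun.compAEEqFun (fun k => (x k).1) (homogFun.powerSum m hr)),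
      homogFun.coeFn_compAEEqFun (fun k => (x k).1) (homogFun.powerSum m hr)] with ω h1 h2 h3 h4
    rw [h1, h2, h3, h4]
    exact (hf _).trans (le_abs_self _)

/-- An operator on an `r`-convex function space with values in a locally `r`-concave space
factors through a weighted `L_r`-seminorm. -/
theorem _root_.LocallyConcave.exists_dominating_functional {𝕜 : Type*} [RCLike 𝕜] {F : Type*}
    [NormedAddCommGroup F] [NormedSpace 𝕜 F] [NormedSpace ℝ F] [IsScalarTower ℝ 𝕜 F] {r c : ℝ}
    (h : LocallyConcave 𝕜 F r c) (hc : 0 ≤ c) (hr : 0 < r) (X : QuasiKotheSpace μ)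
    (hX : X.IsConvex r) (T : X.carrier →ₗ[ℝ] F)
    (hT : ∃ C : ℝ, ∀ x : X.carrier, ‖T x‖ ≤ C * X.qnorm x) :
    ∃ φ : X.power hr →ₗ[ℝ] ℝ, (∀ f : X.power hr, 0 ≤ f.1 → 0 ≤ φ f) ∧
      BddAbove {s : ℝ | ∃ x : X.carrier, X.qnorm x ≤ 1 ∧ s = φ (X.absPowMap hr x) ^ (1 / r)} ∧
      ∀ x : X.carrier, ‖T x‖ ≤ φ (X.absPowMap hr x) ^ (1 / r) := by
  obtain ⟨C', hT'⟩ := hT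
  obtain ⟨C, hC, hT⟩ : ∃ C : ℝ, 0 ≤ C ∧ ∀ x : X.carrier, ‖T x‖ ≤ C * X.qnorm x :=
    ⟨|C'|, abs_nonneg _, fun x => (hT' x).trans
      (mul_le_mul_of_nonneg_right (le_abs_self _) (X.qnorm_nonneg _ x.2))⟩
  obtain ⟨d, hd, hX⟩ := hX
  -- The factors are the local concavity constant, the `2` of `LocallyConcave.sum_coord`, a bound
  -- for `T`, and the `r`-convexity constant.
  set K : ℝ := (c * (2 * (C * d))) ^ r with hK
  have hK0 : 0 ≤ K := Real.rpow_nonneg (by positivity) _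
  have hsum : ∀ l : List X.carrier, ((l.map (X.absPowMap hr)).sum : X.power hr).1
      = ∑ k : Fin l.length, absPow r (l.get k).1 := fun l => by
    induction l with
    | nil => simp
    | cons x l ih =>
      simp only [List.map_cons, List.sum_cons, Submodule.coe_add, ih, List.length_cons,
        Fin.sum_univ_succ]
      rfl
  obtain ⟨φ, hpos, hφ⟩ : ∃ φ : X.power hr →ₗ[ℝ] ℝ, (∀ f : X.power hr, 0 ≤ f.1 → 0 ≤ φ f) ∧
      ∀ x, ‖T x‖ ^ r ≤ φ (X.absPowMap hr x) ∧ φ (X.absPowMap hr x) ≤ K * X.qnorm x ^ r := by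
    refine exists_positive_functional_between
      (fun f : X.power hr => 0 ≤ f.1) le_rfl (fun u v hu hv => add_nonneg hu hv)
      (fun a ha u hu => ?_) (X.absPowMap hr) (fun x => ‖T x‖ ^ r) (fun x => K * X.qnorm x ^ r)
      (fun u => ?_) (fun a ha x => ?_) (fun l l' hll' => ?_)
    · have hu : 0 ≤ u.1 := hu
      change 0 ≤ a • u.1
      rw [← AEEqFun.coeFn_le] at hu ⊢
      filter_upwards [hu, AEEqFun.coeFn_smul a u.1,
        AEEqFun.coeFn_zero (α := Ω) (β := ℝ) (μ := μ)] with ω h1 h2 h3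
      rw [h3] at h1 ⊢
      rw [h2]
      exact mul_nonneg ha.le h1
    -- Every `u` in `X^r` is below `|u|`, which is the `r`-th power of `|u| ^ (1 / r)` in `X`.
    · refine ⟨⟨absPow (1 / r) u.1, u.2⟩, ?_⟩
      change 0 ≤ absPow r (absPow (1 / r) u.1) - u.1
      rw [absPow_absPow_inv hr]
      exact sub_nonneg.2 (le_abs_self _)
    · have h1 : |a ^ (1 / r)| ^ r = a := by
        rw [abs_of_nonneg (by positivity), ← Real.rpow_mul ha.le, one_div_mul_cancel hr.ne',
          Real.rpow_one]
      refine ⟨a ^ (1 / r) • x, Subtype.ext ?_, ?_, ?_⟩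
      · change absPow r (a ^ (1 / r) • x.1) = a • absPow r x.1
        rw [absPow_smul, h1]
      · rw [map_smul, norm_smul, Real.mul_rpow (norm_nonneg _) (norm_nonneg _),
          Real.norm_eq_abs, h1]
      · change K * X.qnorm (a ^ (1 / r) • x.1) ^ r = a * (K * X.qnorm x.1 ^ r)
        rw [X.qnorm_smul _ _ x.2, Real.mul_rpow (abs_nonneg _) (X.qnorm_nonneg _ x.2), h1]
        ring
    -- The sandwich condition: if `∑ |xₖ|^r ≤ ∑ |x'ₖ|^r`, then `r`-concavity of `T`, solidity of `X`
    -- and `r`-convexity of `X`, in this order, lead from `∑ ‖T xₖ‖^r` to `K * ∑ ‖x'ₖ‖^r`.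
    · have hle : ∑ k : Fin l.length, absPow r (l.get k).1 ≤
          ∑ k : Fin l'.length, absPow r (l'.get k).1 := by
        rw [← hsum, ← hsum]
        exact sub_nonneg.1 hll'
      have hnn : ∀ l : List X.carrier, 0 ≤ ∑ k : Fin l.length, absPow r (l.get k).1 :=
        fun l => Finset.sum_nonneg fun k _ => absPow_nonneg _ _
      have hmem := X.absPow_sum_absPow_mem hr l'.get
      have hq := (X.solid _ _ hmem (absPow_abs_le_absPow_abs (t := 1 / r) (by positivity)
        (by rw [abs_of_nonneg (hnn l), abs_of_nonneg (hnn l')]; exact hle))).2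
      have h1 := h.sum_norm_rpow_le hr X T hC hT l.get
      have h2 := hX _ (fun k => (l'.get k).1) fun k => (l'.get k).2
      have hS : 0 ≤ ∑ k : Fin l'.length, X.qnorm (l'.get k).1 ^ r :=
        Finset.sum_nonneg fun k _ => Real.rpow_nonneg (X.qnorm_nonneg _ (l'.get k).2) _
      have hlist : ∀ (l : List X.carrier) (g : X.carrier → ℝ),
          (l.map g).sum = ∑ k : Fin l.length, g (l.get k) := fun l g => by
        induction l with
        | nil => simp
        | cons x l ih =>
          simp only [List.map_cons, List.sum_cons, ih, List.length_cons, Fin.sum_univ_succ]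
          rfl
      rw [hlist, hlist, ← Finset.mul_sum]
      refine h1.trans ?_
      have hq0 := X.qnorm_nonneg _ (X.absPow_sum_absPow_mem hr l.get)
      calc (c * (2 * (C * X.qnorm (absPow (1 / r) (∑ k, absPow r (l.get k).1))))) ^ r
          ≤ (c * (2 * (C * (d * (∑ k, X.qnorm (l'.get k).1 ^ r) ^ (1 / r))))) ^ r := by
            have := hq.trans h2
            exact Real.rpow_le_rpow (by positivity) (by gcongr) hr.le
        _ = (c * (2 * (C * d)) * (∑ k, X.qnorm (l'.get k).1 ^ r) ^ (1 / r)) ^ r := by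
            congr 1; ring
        _ = K * ∑ k, X.qnorm (l'.get k).1 ^ r := by
            rw [Real.mul_rpow (by positivity) (by positivity), ← Real.rpow_mul hS,
              one_div_mul_cancel hr.ne', Real.rpow_one]
  have hφ0 : ∀ x, 0 ≤ φ (X.absPowMap hr x) := fun x => hpos _ (absPow_nonneg _ _)
  refine ⟨φ, hpos, ⟨K ^ (1 / r), ?_⟩, fun x => ?_⟩
  · rintro _ ⟨x, hx, rfl⟩
    refine Real.rpow_le_rpow (hφ0 x) ((hφ x).2.trans ?_) (by positivity)
    exact mul_le_of_le_one_right hK0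
      (Real.rpow_le_one (X.qnorm_nonneg _ x.2) hx hr.le)
  · refine le_trans (le_of_eq ?_)
      (Real.rpow_le_rpow (Real.rpow_nonneg (norm_nonneg _) _) (hφ x).1 (by positivity))
    rw [← Real.rpow_mul (norm_nonneg _), mul_one_div_cancel hr.ne', Real.rpow_one]

end QuasiKotheSpace

end FunctionSpaces

/-! ### Operators on the space of bounded sequences -/

/-- Every operator from the space of bounded sequences into `F` is `r`-concave. -/
def ConcaveOnBoundedSequences (F : Type*) [NormedAddCommGroup F] [NormedSpace ℝ F] (r : ℝ) : Prop :=
  ∀ T : (ℕ →ᵇ ℝ) →L[ℝ] F, ∃ c : ℝ, ∀ (m : ℕ) (f : Fin m → ℕ →ᵇ ℝ),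
    (∀ i, ∑ k, |f k i| ^ r ≤ 1) → ∑ k, ‖T (f k)‖ ^ r ≤ c

theorem abs_le_one_of_sum_rpow_le_one {κ : Type*} [Fintype κ] {r : ℝ} (hr : 0 < r) {a : κ → ℝ}
    (h : ∑ k, |a k| ^ r ≤ 1) (k : κ) : |a k| ≤ 1 := by
  rw [← Real.rpow_le_rpow_iff (abs_nonneg _) zero_le_one hr, Real.one_rpow]
  exact (Finset.single_le_sum (f := fun k => |a k| ^ r)
    (fun _ _ => Real.rpow_nonneg (abs_nonneg _) _) (Finset.mem_univ k)).trans h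

/-- A Banach space is barrelled: a pointwise finite supremum of continuous seminorms is continuous.
-/
theorem Seminorm.exists_uniform_bound {E ι : Type*} [NormedAddCommGroup E] [NormedSpace ℝ E]
    [CompleteSpace E] (p : ι → Seminorm ℝ E) (hpc : ∀ i, Continuous (p i))
    (hp : ∀ x, BddAbove (Set.range fun i => p i x)) :
    ∃ C : ℝ, 0 ≤ C ∧ ∀ i x, p i x ≤ C * ‖x‖ := by
  have hbdd : BddAbove (Set.range p) := Seminorm.bddAbove_range_iff.2 hp
  have hcont := Seminorm.continuous_iSup p hpc hbdd
  rw [← Seminorm.coe_iSup_eq hbdd] at hcont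
  obtain ⟨C, hC, hbound⟩ := Seminorm.bound_of_continuous_normedSpace _ hcont
  exact ⟨C, hC.le, fun i x => (le_ciSup hbdd i x).trans (hbound x)⟩

theorem ConcaveOnBoundedSequences.exists_uniform_bound {F : Type*} [NormedAddCommGroup F]
    [NormedSpace ℝ F] [CompleteSpace F] {r : ℝ} (hr : 1 ≤ r)
    (h : ConcaveOnBoundedSequences F r) :
    ∃ C : ℝ, 0 ≤ C ∧ ∀ (T : (ℕ →ᵇ ℝ) →L[ℝ] F) (m : ℕ) (f : Fin m → ℕ →ᵇ ℝ),
      (∀ i, ∑ k, |f k i| ^ r ≤ 1) → ∑ k, ‖T (f k)‖ ^ r ≤ (C * ‖T‖) ^ r := by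
  have hr0 : 0 < r := by linarith
  set q := ENNReal.ofReal r with hq
  have : Fact (1 ≤ q) := ⟨by rw [hq, ← ENNReal.ofReal_one]; exact ENNReal.ofReal_le_ofReal hr⟩
  have hqr : q.toReal = r := ENNReal.toReal_ofReal hr0.le
  let ι := {g : Σ m : ℕ, Fin m → ℕ →ᵇ ℝ // ∀ i, ∑ k, |g.2 k i| ^ r ≤ 1}
  -- For fixed test functions the `r`-sum is the `ℓ_r`-norm of a vector depending linearly on `T`,
  -- hence a seminorm on the space of operators.
  let p : ι → Seminorm ℝ ((ℕ →ᵇ ℝ) →L[ℝ] F) := fun g =>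
    (normSeminorm ℝ (PiLp q fun _ : Fin g.1.1 => F)).comp
      ((WithLp.linearEquiv q ℝ (Fin g.1.1 → F)).symm.toLinearMap.comp
        (LinearMap.pi fun k => (ContinuousLinearMap.apply ℝ F (g.1.2 k)).toLinearMap))
  have hp : ∀ g T, p g T = (∑ k, ‖T (g.1.2 k)‖ ^ r) ^ (1 / r) := fun g T => by
    change ‖(WithLp.toLp q fun k => T (g.1.2 k) : PiLp q fun _ : Fin g.1.1 => F)‖ = _
    rw [PiLp.norm_eq_sum (by rw [hqr]; exact hr0), hqr]
  have hpc : ∀ g, Continuous (p g) := fun g => by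
    have : (p g : ((ℕ →ᵇ ℝ) →L[ℝ] F) → ℝ) = fun T => (∑ k, ‖T (g.1.2 k)‖ ^ r) ^ (1 / r) :=
      funext (hp g)
    rw [this]
    refine Continuous.rpow_const (continuous_finsetSum _ fun k _ => ?_)
      fun _ => Or.inr (by positivity)
    exact (ContinuousLinearMap.apply ℝ F (g.1.2 k)).continuous.norm.rpow_const
      fun _ => Or.inr hr0.le
  have hbdd : ∀ T, BddAbove (Set.range fun g => p g T) := by
    intro T
    obtain ⟨c, hc⟩ := h T
    refine ⟨c ^ (1 / r), ?_⟩
    rintro _ ⟨g, rfl⟩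
    simp only [hp]
    exact Real.rpow_le_rpow (Finset.sum_nonneg fun _ _ => Real.rpow_nonneg (norm_nonneg _) _)
      (hc _ _ g.2) (by positivity)
  obtain ⟨C, hC, hbound⟩ := Seminorm.exists_uniform_bound
    (E := (ℕ →ᵇ ℝ) →L[ℝ] F) p hpc hbdd
  refine ⟨C, hC, fun T m f hf => ?_⟩
  have h1 : p ⟨⟨m, f⟩, hf⟩ T ≤ C * ‖T‖ := hbound _ T
  rw [hp] at h1
  have h0 : 0 ≤ ∑ k, ‖T (f k)‖ ^ r :=
    Finset.sum_nonneg fun _ _ => Real.rpow_nonneg (norm_nonneg _) _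
  have h2 := Real.rpow_le_rpow (by positivity) h1 hr0.le
  rwa [← Real.rpow_mul h0, one_div_mul_cancel hr0.ne', Real.rpow_one] at h2

/-- The vectors `x i` define an operator on bounded sequences that sees only the first `n`
coordinates and has norm at most one; the columns of the matrix `a`, extended by zero, serve as test
sequences. -/
theorem ConcaveOnBoundedSequences.exists_locallyConcave {𝕜 : Type*} [RCLike 𝕜] {F : Type*}
    [NormedAddCommGroup F] [NormedSpace 𝕜 F] [NormedSpace ℝ F] [IsScalarTower ℝ 𝕜 F]
    [CompleteSpace F] {r : ℝ} (hr : 1 ≤ r) (h : ConcaveOnBoundedSequences F r) :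
    ∃ c : ℝ, 0 ≤ c ∧ LocallyConcave 𝕜 F r c := by
  have hr0 : 0 < r := by linarith
  obtain ⟨C, hC, hbound⟩ := h.exists_uniform_bound hr
  refine ⟨C, hC, LocallyConcave.of_unit hr hC fun n m x a hx ha => ?_⟩
  let L : (ℕ →ᵇ ℝ) →ₗ[ℝ] F :=
    { toFun := fun f => ∑ i, f (i : Fin n).1 • x i
      map_add' := fun f g => by simp [add_smul, Finset.sum_add_distrib]
      map_smul' := fun c f => by simp [mul_smul, Finset.smul_sum] }
  have hL : ∀ f, ‖L f‖ ≤ 1 * ‖f‖ := fun f => by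
    obtain ⟨φ, hφ, hφL⟩ := exists_dual_vector'' 𝕜 (L f)
    have h1 : ‖L f‖ = ‖φ (L f)‖ := by simp [hφL]
    rw [h1, one_mul]
    calc ‖φ (L f)‖ = ‖∑ i, φ (f (i : Fin n).1 • x i)‖ := by
          change ‖φ (∑ i, f (i : Fin n).1 • x i)‖ = _
          rw [map_sum]
      _ ≤ ∑ i, ‖f‖ * ‖φ (x i)‖ := by
          refine (norm_sum_le _ _).trans (Finset.sum_le_sum fun i _ => ?_)
          rw [← algebraMap_smul 𝕜 (f i.1) (x i), map_smul, norm_smul, norm_algebraMap']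
          exact mul_le_mul_of_nonneg_right (f.norm_coe_le_norm _) (norm_nonneg _)
      _ ≤ ‖f‖ := by
          rw [← Finset.mul_sum]
          exact mul_le_of_le_one_right (norm_nonneg _) (hx φ hφ)
  let T := L.mkContinuous 1 hL
  have hT : ‖T‖ ≤ 1 := L.mkContinuous_norm_le zero_le_one hL
  let f : Fin m → ℕ →ᵇ ℝ := fun k =>
    BoundedContinuousFunction.ofNormedAddCommGroupDiscrete
      (fun i => if h : i < n then a ⟨i, h⟩ k else 0) 1 fun i => by
        split_ifs with hi
        · exact abs_le_one_of_sum_rpow_le_one hr0 (ha ⟨i, hi⟩) k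
        · simp
  have hf : ∀ k i, f k i = if h : i < n then a ⟨i, h⟩ k else 0 := fun k i => rfl
  have key := hbound T m f fun i => by
    by_cases hi : i < n
    · simpa [hf, hi] using ha ⟨i, hi⟩
    · simp [hf, hi, Real.zero_rpow hr0.ne']
  have hTf : ∀ k, T (f k) = ∑ i, a i k • x i := fun k => by
    change ∑ i, f k (i : Fin n).1 • x i = _
    simp [hf]
  simp only [hTf] at key
  exact key.trans (Real.rpow_le_rpow (by positivity) (mul_le_of_le_one_right hC hT) hr0.le)

/-! ### Bounded functions as a Banach lattice -/

section BoundedLattice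

variable {α : Type*} [TopologicalSpace α]

instance : IsOrderedModule ℝ (α →ᵇ ℝ) where
  smul_le_smul_of_nonneg_left a ha _ _ h := by
    intro x
    exact mul_le_mul_of_nonneg_left (h x) ha
  smul_le_smul_of_nonneg_right f hf _ _ h := by
    intro x
    exact mul_le_mul_of_nonneg_right h (hf x)

/-- The function `h(f₁, …, fₘ)`. -/
noncomputable def homogFun.compBounded {m : ℕ} (f : Fin m → α →ᵇ ℝ) :
    homogFun m →ₗ[ℝ] (α →ᵇ ℝ) where
  toFun h := BoundedContinuousFunction.ofNormedAddCommGroup (fun x => h.1 fun k => f k x)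
    (h.2.1.comp (continuous_pi fun k => (f k).continuous))
    ((homogFun.exists_bound h).choose * ∑ k, ‖f k‖) fun x =>
      ((homogFun.exists_bound h).choose_spec.2 _).trans
        (mul_le_mul_of_nonneg_left (Finset.sum_le_sum fun k _ => (f k).norm_coe_le_norm x)
          (homogFun.exists_bound h).choose_spec.1)
  map_add' _ _ := rfl
  map_smul' _ _ := rfl

theorem homogFun.isKrivineValue_compBounded {m : ℕ} (h : homogFun m) (f : Fin m → α →ᵇ ℝ) :
    IsKrivineValue h f (homogFun.compBounded f h) :=
  ⟨homogFun.compBounded f, fun _ _ => rfl, fun _ => rfl, rfl⟩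

end BoundedLattice

universe u

/-- The index set is lifted so that the lattice can lie in a prescribed universe. Its functional
calculus is pointwise, so the `r`-sum of the test functions has norm at most one. -/
theorem concaveOnBoundedSequences_of_isConcaveOperator {F : Type*} [NormedAddCommGroup F]
    [NormedSpace ℝ F] {r : ℝ} (hr : 0 < r)
    (h : ∀ T : (ULift.{u} ℕ →ᵇ ℝ) →L[ℝ] F, IsConcaveOperator hr T) :
    ConcaveOnBoundedSequences F r := by
  intro T
  let P : (ULift.{u} ℕ →ᵇ ℝ) →ₗ[ℝ] (ℕ →ᵇ ℝ) :=
    { toFun := fun f => f.compContinuous ⟨ULift.up, continuous_of_discreteTopology⟩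
      map_add' := fun _ _ => rfl
      map_smul' := fun _ _ => rfl }
  have hP : ∀ f, ‖P f‖ ≤ 1 * ‖f‖ := fun f => by
    rw [one_mul]
    exact (BoundedContinuousFunction.norm_le (norm_nonneg _)).2 fun i => f.norm_coe_le_norm _
  obtain ⟨c, hc, hT⟩ := h (T.comp (P.mkContinuous 1 hP))
  refine ⟨c ^ r, fun m f hf => ?_⟩
  let g : Fin m → ULift.{u} ℕ →ᵇ ℝ := fun k =>
    (f k).compContinuous ⟨ULift.down, continuous_of_discreteTopology⟩
  have hg : ∀ k, P (g k) = f k := fun k => rfl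
  have key := hT m g _ (homogFun.isKrivineValue_compBounded _ g)
  have hnorm : ‖homogFun.compBounded g (homogFun.powerSum m hr)‖ ≤ 1 := by
    refine (BoundedContinuousFunction.norm_le zero_le_one).2 fun i => ?_
    change |(∑ k, |f k i.down| ^ r) ^ (1 / r)| ≤ 1
    have h0 : 0 ≤ ∑ k, |f k i.down| ^ r :=
      Finset.sum_nonneg fun _ _ => Real.rpow_nonneg (abs_nonneg _) _
    rw [abs_of_nonneg (by positivity)]
    exact Real.rpow_le_one h0 (hf _) (by positivity)
  have h0 : 0 ≤ ∑ k, ‖T (f k)‖ ^ r :=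
    Finset.sum_nonneg fun _ _ => Real.rpow_nonneg (norm_nonneg _) _
  have h1 : (∑ k, ‖T (f k)‖ ^ r) ^ (1 / r) ≤ c :=
    key.trans (mul_le_of_le_one_right hc hnorm)
  have h2 := Real.rpow_le_rpow (by positivity) h1 hr.le
  rwa [← Real.rpow_mul h0, one_div_mul_cancel hr.ne', Real.rpow_one] at h2

/-! ### Bounded functions on a countable set as a Banach function space -/

section BoundedFunctionSpace

variable (Ω : Type*) [MeasurableSpace Ω] [MeasurableSingletonClass Ω] [Countable Ω]

theorem MeasureTheory.Measure.count_isComplete : (Measure.count : Measure Ω).IsComplete :=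
  ⟨fun _ _ => .of_discrete⟩

variable [Nonempty Ω]

/-- The space of bounded functions with the supremum norm. -/
noncomputable def boundedFunctionSpace : QuasiBanachFunctionSpace (Measure.count : Measure Ω) where
  carrier :=
    { carrier := {x | BddAbove (Set.range fun ω => |x ω|)}
      add_mem' := by
        rintro x y ⟨a, ha⟩ ⟨b, hb⟩
        refine ⟨a + b, ?_⟩
        rintro _ ⟨ω, rfl⟩
        have h := Measure.ae_count_iff.1 (AEEqFun.coeFn_add x y) ω
        simp only [h, Pi.add_apply]
        exact (abs_add_le _ _).trans (add_le_add (ha ⟨ω, rfl⟩) (hb ⟨ω, rfl⟩))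
      zero_mem' := by
        refine ⟨0, ?_⟩
        rintro _ ⟨ω, rfl⟩
        have h := Measure.ae_count_iff.1
          (AEEqFun.coeFn_zero (α := Ω) (β := ℝ) (μ := Measure.count)) ω
        simp only [h, Pi.zero_apply, abs_zero, le_refl]
      smul_mem' := by
        rintro c x ⟨a, ha⟩
        refine ⟨|c| * a, ?_⟩
        rintro _ ⟨ω, rfl⟩
        have h := Measure.ae_count_iff.1 (AEEqFun.coeFn_smul c x) ω
        simp only [h, Pi.smul_apply, smul_eq_mul, abs_mul]
        exact mul_le_mul_of_nonneg_left (ha ⟨ω, rfl⟩) (abs_nonneg _) }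
  qnorm x := ⨆ ω, |x ω|
  qnorm_nonneg x _ := Real.iSup_nonneg fun _ => abs_nonneg _
  eq_zero_of_qnorm x hx h := by
    apply AEEqFun.ext
    refine Measure.ae_count_iff.2 fun ω => ?_
    rw [Measure.ae_count_iff.1 (AEEqFun.coeFn_zero (α := Ω) (β := ℝ) (μ := Measure.count)) ω]
    exact abs_nonpos_iff.1 (h ▸ le_ciSup hx ω)
  qnorm_smul a x _ := by
    rw [Real.mul_iSup_of_nonneg (abs_nonneg _)]
    refine iSup_congr fun ω => ?_
    rw [Measure.ae_count_iff.1 (AEEqFun.coeFn_smul a x) ω, Pi.smul_apply, smul_eq_mul, abs_mul]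
  qnorm_add := by
    refine ⟨1, fun x hx y hy => ?_⟩
    rw [one_mul]
    refine ciSup_le fun ω => ?_
    rw [Measure.ae_count_iff.1 (AEEqFun.coeFn_add x y) ω]
    exact (abs_add_le _ _).trans (add_le_add (le_ciSup hx ω) (le_ciSup hy ω))
  solid x y hy hxy := by
    have h : ∀ ω, |x ω| ≤ |y ω| := fun ω => by
      have := Measure.ae_count_iff.1 (AEEqFun.coeFn_le.2 hxy) ω
      rwa [Measure.ae_count_iff.1 (AEEqFun.coeFn_abs x) ω,
        Measure.ae_count_iff.1 (AEEqFun.coeFn_abs y) ω] at this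
    refine ⟨?_, ciSup_mono hy h⟩
    obtain ⟨b, hb⟩ := hy
    exact ⟨b, by rintro _ ⟨ω, rfl⟩; exact (h ω).trans (hb ⟨ω, rfl⟩)⟩
  lower_convex := by
    refine ⟨1, one_pos, fun x hx y hy => ?_⟩
    simp only [Real.rpow_one, div_one]
    refine ciSup_le fun ω => ?_
    rw [Measure.ae_count_iff.1 (coeFn_absPow 1 (absPow 1 x + absPow 1 y)) ω,
      Measure.ae_count_iff.1 (AEEqFun.coeFn_add (absPow 1 x) (absPow 1 y)) ω, Pi.add_apply,
      Measure.ae_count_iff.1 (coeFn_absPow 1 x) ω, Measure.ae_count_iff.1 (coeFn_absPow 1 y) ω]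
    simp only [Real.rpow_one, abs_abs]
    rw [abs_of_nonneg (by positivity)]
    exact add_le_add (le_ciSup hx ω) (le_ciSup hy ω)
  full_support A _ h := by
    have h1 := Measure.ae_count_iff.1 (AEEqFun.coeFn_mk (μ := Measure.count) (fun _ : Ω => (1 : ℝ))
      aestronglyMeasurable_const)
    have h2 := Measure.ae_count_iff.1 (h (AEEqFun.mk (fun _ => 1) aestronglyMeasurable_const)
      ⟨1, by rintro _ ⟨ω, rfl⟩; simp [h1]⟩)
    have : A = ∅ := Set.eq_empty_of_forall_notMem fun ω hω => by simpa [h1] using h2 ω hω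
    simp [this]
  fatou u x hu hx hu0 hx0 hmono hlim := by
    have hlim := Measure.ae_count_iff.1 hlim
    have hmono' : ∀ ω, Monotone fun n => u n ω := fun ω n m hnm =>
      Measure.ae_count_iff.1 (AEEqFun.coeFn_le.2 (hmono hnm)) ω
    have hu0' : ∀ n ω, 0 ≤ u n ω := fun n ω => by
      have := Measure.ae_count_iff.1 (AEEqFun.coeFn_le.2 (hu0 n)) ω
      rwa [Measure.ae_count_iff.1
        (AEEqFun.coeFn_zero (α := Ω) (β := ℝ) (μ := Measure.count)) ω] at this
    have hle : ∀ n ω, u n ω ≤ x ω := fun n ω => (hmono' ω).ge_of_tendsto (hlim ω) n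
    refine tendsto_order.2 ⟨fun a ha => ?_, fun a ha => .of_forall fun n => ?_⟩
    · obtain ⟨ω, hω⟩ := exists_lt_of_lt_ciSup ha
      filter_upwards [((hlim ω).abs).eventually (lt_mem_nhds hω)] with n hn
      exact hn.trans_le (le_ciSup (hu n) ω)
    · refine lt_of_le_of_lt (ciSup_mono hx fun ω => ?_) ha
      exact abs_le_abs_of_nonneg (hu0' n ω) (hle n ω)
  complete u hu hcauchy := by
    have hsub : ∀ m n ω, (u m - u n) ω = u m ω - u n ω := fun m n ω =>
      Measure.ae_count_iff.1 (AEEqFun.coeFn_sub (u m) (u n)) ω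
    have hbdd : ∀ m n, BddAbove (Set.range fun ω => |(u m - u n) ω|) := fun m n => by
      obtain ⟨a, ha⟩ := hu m
      obtain ⟨b, hb⟩ := hu n
      refine ⟨a + b, ?_⟩
      rintro _ ⟨ω, rfl⟩
      simp only [hsub]
      exact (abs_sub _ _).trans (add_le_add (ha ⟨ω, rfl⟩) (hb ⟨ω, rfl⟩))
    have hc : ∀ ε : ℝ, 0 < ε → ∃ N, ∀ m ≥ N, ∀ n ≥ N, ∀ ω, |u m ω - u n ω| ≤ ε := by
      intro ε hε
      obtain ⟨N, hN⟩ := hcauchy ε hε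
      refine ⟨N, fun m hm n hn ω => ?_⟩
      rw [← hsub]
      exact (le_ciSup (hbdd m n) ω).trans (hN m hm n hn).le
    have hconv : ∀ ω, ∃ a, Tendsto (fun n => u n ω) atTop (𝓝 a) := fun ω => by
      refine cauchySeq_tendsto_of_complete (Metric.cauchySeq_iff.2 fun ε hε => ?_)
      obtain ⟨N, hN⟩ := hc (ε / 2) (half_pos hε)
      exact ⟨N, fun m hm n hn => (hN m hm n hn ω).trans_lt (half_lt_self hε)⟩
    choose g hg using hconv
    have hlim : ∀ ε : ℝ, 0 < ε → ∃ N, ∀ m ≥ N, ∀ ω, |u m ω - g ω| ≤ ε := fun ε hε => by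
      obtain ⟨N, hN⟩ := hc ε hε
      refine ⟨N, fun m hm ω => le_of_tendsto ((tendsto_const_nhds.sub (hg ω)).abs) ?_⟩
      filter_upwards [eventually_ge_atTop N] with n hn using hN m hm n hn ω
    let x : Ω →ₘ[Measure.count] ℝ := AEEqFun.mk g Measurable.of_discrete.aestronglyMeasurable
    have hx : ∀ ω, x ω = g ω := Measure.ae_count_iff.1 (AEEqFun.coeFn_mk _ _)
    refine ⟨x, ?_, ?_⟩
    · obtain ⟨N, hN⟩ := hlim 1 one_pos
      obtain ⟨b, hb⟩ := hu N
      refine ⟨b + 1, ?_⟩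
      rintro _ ⟨ω, rfl⟩
      have h1 := abs_le.1 (hN N le_rfl ω)
      have h2 := abs_le.1 (show |u N ω| ≤ b from hb ⟨ω, rfl⟩)
      simp only [hx]
      exact abs_le.2 ⟨by linarith [h1.2], by linarith [h1.1]⟩
    · rw [Metric.tendsto_atTop]
      intro ε hε
      obtain ⟨N, hN⟩ := hlim (ε / 2) (half_pos hε)
      refine ⟨N, fun n hn => ?_⟩
      rw [Real.dist_0_eq_abs, abs_of_nonneg (Real.iSup_nonneg fun _ => abs_nonneg _)]
      refine lt_of_le_of_lt (ciSup_le fun ω => ?_) (half_lt_self hε)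
      rw [Measure.ae_count_iff.1 (AEEqFun.coeFn_sub (u n) x) ω, Pi.sub_apply, hx]
      exact hN n hn ω

theorem boundedFunctionSpace_isConvex {r : ℝ} (hr : 0 < r) :
    (boundedFunctionSpace Ω).IsConvex r := by
  refine ⟨1, zero_le_one, fun n x hx => ?_⟩
  rw [one_mul]
  refine ciSup_le fun ω => ?_
  rw [← homogFun.compAEEqFun_powerSum hr,
    Measure.ae_count_iff.1 (homogFun.coeFn_compAEEqFun x (homogFun.powerSum n hr)) ω,
    abs_of_nonneg (homogFun.powerSum_nonneg hr _)]
  refine Real.rpow_le_rpow (Finset.sum_nonneg fun _ _ => Real.rpow_nonneg (abs_nonneg _) _)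
    (Finset.sum_le_sum fun k _ => ?_) (by positivity)
  exact Real.rpow_le_rpow (abs_nonneg _) (le_ciSup (hx k) ω) hr.le

end BoundedFunctionSpace

/-- If `∑ |fₖ|^r ≤ 1` pointwise, positivity gives `∑ ‖T fₖ‖^r ≤ φ(∑ |fₖ|^r) ≤ φ(1)`, so `φ(1)`
serves as the constant. -/
theorem concaveOnBoundedSequences_of_dominated {F : Type*} [NormedAddCommGroup F]
    [NormedSpace ℝ F] {r : ℝ} (hr : 0 < r)
    (h : ∀ T : (boundedFunctionSpace (ULift.{u} ℕ)).carrier →ₗ[ℝ] F,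
      (∃ C : ℝ, ∀ x : (boundedFunctionSpace (ULift.{u} ℕ)).carrier,
        ‖T x‖ ≤ C * (boundedFunctionSpace (ULift.{u} ℕ)).qnorm x) →
      ∃ φ : (boundedFunctionSpace (ULift.{u} ℕ)).power hr →ₗ[ℝ] ℝ,
        (∀ f : (boundedFunctionSpace (ULift.{u} ℕ)).power hr, 0 ≤ f.1 → 0 ≤ φ f) ∧
        ∀ x : (boundedFunctionSpace (ULift.{u} ℕ)).carrier,
          ‖T x‖ ≤ φ ((boundedFunctionSpace (ULift.{u} ℕ)).absPowMap hr x) ^ (1 / r)) :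
    ConcaveOnBoundedSequences F r := by
  intro T
  set X := boundedFunctionSpace (ULift.{u} ℕ) with hX
  let P : X.carrier →ₗ[ℝ] (ℕ →ᵇ ℝ) :=
    { toFun := fun x => BoundedContinuousFunction.ofNormedAddCommGroupDiscrete
        (fun i => x.1 (ULift.up i)) (X.qnorm x.1) fun i => le_ciSup x.2 (ULift.up i)
      map_add' := fun x y => by
        ext i
        exact Measure.ae_count_iff.1 (AEEqFun.coeFn_add x.1 y.1) (ULift.up i)
      map_smul' := fun c x => by
        ext i
        exact Measure.ae_count_iff.1 (AEEqFun.coeFn_smul c x.1) (ULift.up i) }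
  have hP : ∀ x, ‖P x‖ ≤ X.qnorm x.1 := fun x =>
    (BoundedContinuousFunction.norm_le (X.qnorm_nonneg _ x.2)).2 fun i =>
      le_ciSup x.2 (ULift.up i)
  obtain ⟨φ, hpos, hφ⟩ := h (T.toLinearMap.comp P) ⟨‖T‖, fun x =>
    (T.le_opNorm _).trans (mul_le_mul_of_nonneg_left (hP x) (norm_nonneg _))⟩
  let emb : (ℕ →ᵇ ℝ) → X.carrier := fun f =>
    ⟨AEEqFun.mk (fun ω => f ω.down) Measurable.of_discrete.aestronglyMeasurable, ‖f‖, by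
      rintro _ ⟨ω, rfl⟩
      simp only [Measure.ae_count_iff.1 (AEEqFun.coeFn_mk (μ := Measure.count)
        (fun ω : ULift.{u} ℕ => f ω.down) Measurable.of_discrete.aestronglyMeasurable) ω]
      exact f.norm_coe_le_norm _⟩
  have hemb : ∀ f ω, (emb f).1 ω = f ω.down := fun f =>
    Measure.ae_count_iff.1 (AEEqFun.coeFn_mk _ _)
  have hPemb : ∀ f, P (emb f) = f := fun f => by
    ext i
    exact hemb f (ULift.up i)
  let one := X.absPowMap hr (emb 1)
  refine ⟨φ one, fun m f hf => ?_⟩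
  have h1 : ∀ k, ‖T (f k)‖ ^ r ≤ φ (X.absPowMap hr (emb (f k))) := fun k => by
    have := hφ (emb (f k))
    rw [LinearMap.comp_apply, hPemb] at this
    have h0 : 0 ≤ φ (X.absPowMap hr (emb (f k))) := hpos _ (absPow_nonneg r (emb (f k)).1)
    have h2 := Real.rpow_le_rpow (norm_nonneg _) this hr.le
    rwa [← Real.rpow_mul h0, one_div_mul_cancel hr.ne', Real.rpow_one] at h2
  refine (Finset.sum_le_sum fun k _ => h1 k).trans ?_
  rw [← map_sum, ← sub_nonneg, ← map_sub]
  refine hpos _ ?_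
  have hval : (one - ∑ k, X.absPowMap hr (emb (f k))).1
      = absPow r (emb 1).1 - ∑ k, absPow r (emb (f k)).1 := by
    simp [one, QuasiKotheSpace.absPowMap]
  rw [hval, sub_nonneg, ← AEEqFun.coeFn_le]
  refine Measure.ae_count_iff.2 fun ω => ?_
  rw [Measure.ae_count_iff.1 (coeFn_absPow r (emb 1).1) ω,
    Measure.ae_count_iff.1 (coeFn_sum_absPow r fun k => (emb (f k)).1) ω]
  simp only [hemb]
  simpa using hf ω.down

/-! ### Summing operators on locally concave spaces -/

/-- A finite-dimensional minimax argument: otherwise the open orthant above `b - ε` could be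
separated from the convex hull, and the separating functional, having a sign, would violate the
hypothesis. -/
theorem exists_mem_convexHull_dominating {n : ℕ} (V : Set (Fin n → ℝ)) (b : Fin n → ℝ)
    (h : ∀ l : Fin n → ℝ, (∀ i, 0 ≤ l i) → ∀ δ : ℝ, 0 < δ →
      ∃ v ∈ V, ∑ i, l i * b i ≤ ∑ i, l i * v i + δ) {ε : ℝ} (hε : 0 < ε) :
    ∃ v ∈ convexHull ℝ V, ∀ i, b i ≤ v i + ε := by
  by_contra! hcon
  let U : Set (Fin n → ℝ) := Set.univ.pi fun i => Set.Ioi (b i - ε)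
  have hU : IsOpen U := isOpen_set_pi Set.finite_univ fun i _ => isOpen_Ioi
  have hUconv : Convex ℝ U := convex_pi fun i _ => convex_Ioi _
  have hdisj : Disjoint U (convexHull ℝ V) := by
    rw [Set.disjoint_left]
    intro u hu hv
    obtain ⟨i, hi⟩ := hcon u hv
    have : b i - ε < u i := hu i (Set.mem_univ i)
    linarith
  obtain ⟨f, c, hfU, hfV⟩ := geometric_hahn_banach_open hUconv hU (convex_convexHull ℝ V) hdisj
  let l : Fin n → ℝ := fun i => -f (Pi.single i 1)
  have hf : ∀ u, f u = -∑ i, l i * u i := fun u => by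
    conv_lhs => rw [pi_eq_sum_univ' u]
    simp [l, mul_comm]
  have hbU : b ∈ U := fun i _ => by simpa using hε
  -- The orthant is closed under increasing coordinates. With a negative `l i`, the step `t` along
  -- that coordinate would bring `f` exactly to the separating value `c`.
  have hl : ∀ i, 0 ≤ l i := fun i => by
    by_contra! hneg
    set t := (f b - c) / l i with ht
    have ht0 : 0 ≤ t := div_nonneg_of_nonpos (by linarith [hfU b hbU]) hneg.le
    have hmem : b + t • Pi.single i (1 : ℝ) ∈ U := fun j _ => by
      have : 0 ≤ (t • Pi.single i (1 : ℝ) : Fin n → ℝ) j := by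
        by_cases hij : j = i
        · subst hij; simpa using ht0
        · simp [hij]
      simp only [Set.mem_Ioi, Pi.add_apply]
      linarith
    have h1 := hfU _ hmem
    rw [map_add, map_smul, smul_eq_mul] at h1
    have h2 : t * f (Pi.single i 1) = c - f b := by
      have : f (Pi.single i 1) = -l i := by simp [l]
      rw [this, ht]
      field_simp [hneg.ne]
      ring
    linarith
  have hb := hfU b hbU
  rw [hf] at hb
  -- The tolerance is half of the gap `c - f b`, so `f v` would still be below `c`.
  obtain ⟨v, hv, hle⟩ := h l hl ((∑ i, l i * b i + c) / 2) (by linarith)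
  have := hfV v (subset_convexHull ℝ V hv)
  rw [hf] at this
  linarith

section Summing

variable {𝕜 : Type*} [RCLike 𝕜] {F : Type*} [NormedAddCommGroup F] [NormedSpace 𝕜 F]

/-- Dual weights linearize each inner `ℓ_q`-norm; exchanging the sums leaves `∑ₖ ψₖ(∑ᵢ aᵢₖ xᵢ)`,
which Hölder and local concavity control. -/
theorem LocallyConcave.sum_norm_functional_le [NormedSpace ℝ F] [IsScalarTower ℝ 𝕜 F] {r q c : ℝ}
    (h : LocallyConcave 𝕜 F r c) (hc : 0 ≤ c) (hrq : r.HolderConjugate q) {n : ℕ} (x : Fin n → F)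
    {w : ℝ} (hw : 0 ≤ w) (hx : ∀ φ : F →L[𝕜] 𝕜, ‖φ‖ ≤ 1 → ∑ i, ‖φ (x i)‖ ≤ w)
    {κ : Type*} [Fintype κ] (ψ : κ → F →L[𝕜] 𝕜) (hψ : ∑ k, ‖ψ k‖ ^ q ≤ 1) :
    ∑ i, (∑ k, ‖ψ k (x i)‖ ^ q) ^ (1 / q) ≤ 2 * (c * w) := by
  choose b hb0 hb1 hb using fun i => exists_dual_weights hrq.symm (fun k => ‖ψ k (x i)‖)
    fun k => norm_nonneg _
  choose u hu1 hu using fun (i : Fin n) (k : κ) => RCLike.exists_norm_eq_mul_self (ψ k (x i))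
  let a : Fin n → κ → 𝕜 := fun i k => (b i k : 𝕜) * u i k
  have ha : ∀ i k, ‖a i k‖ = b i k := fun i k => by
    simp [a, hu1, abs_of_nonneg (hb0 i k)]
  have key := h.sum_scalar hrq.lt.le hc x a hw hx fun i => by simpa only [ha] using hb1 i
  have hsum : ((∑ i, (∑ k, ‖ψ k (x i)‖ ^ q) ^ (1 / q) : ℝ) : 𝕜)
      = ∑ k, ψ k (∑ i, a i k • x i) := by
    simp only [← hb, map_sum, map_smul, smul_eq_mul, RCLike.ofReal_mul, hu]
    rw [Finset.sum_comm]
    exact Finset.sum_congr rfl fun k _ => Finset.sum_congr rfl fun i _ => by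
      simp only [a]; ring
  have hnn : 0 ≤ ∑ i, (∑ k, ‖ψ k (x i)‖ ^ q) ^ (1 / q) :=
    Finset.sum_nonneg fun i _ => Real.rpow_nonneg
      (Finset.sum_nonneg fun k _ => Real.rpow_nonneg (norm_nonneg _) _) _
  have hSψ : 0 ≤ ∑ k, ‖ψ k‖ ^ q := Finset.sum_nonneg fun k _ => Real.rpow_nonneg (norm_nonneg _) _
  calc ∑ i, (∑ k, ‖ψ k (x i)‖ ^ q) ^ (1 / q)
      = ‖∑ k, ψ k (∑ i, a i k • x i)‖ := by
        rw [← hsum, RCLike.norm_ofReal, abs_of_nonneg hnn]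
    _ ≤ ∑ k, ‖ψ k‖ * ‖∑ i, a i k • x i‖ :=
        (norm_sum_le _ _).trans (Finset.sum_le_sum fun k _ => (ψ k).le_opNorm _)
    _ ≤ (∑ k, |‖ψ k‖| ^ q) ^ (1 / q) * (∑ k, |‖∑ i, a i k • x i‖| ^ r) ^ (1 / r) :=
        Real.inner_le_Lp_mul_Lq _ _ _ hrq.symm
    _ ≤ 1 * ((2 * (c * w)) ^ r) ^ (1 / r) := by
        simp only [abs_norm]
        refine mul_le_mul (Real.rpow_le_one hSψ hψ (one_div_nonneg.2 hrq.symm.nonneg))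
          (Real.rpow_le_rpow (Finset.sum_nonneg fun k _ => Real.rpow_nonneg (norm_nonneg _) _) key
            (one_div_nonneg.2 hrq.nonneg)) (by positivity) zero_le_one
    _ = 2 * (c * w) := by
        rw [one_mul, ← Real.rpow_mul (by positivity), mul_one_div_cancel hrq.ne_zero,
          Real.rpow_one]

variable {G : Type*} [NormedAddCommGroup G] [NormedSpace 𝕜 G]

/-- Pietsch domination on finitely many vectors, up to `ε`. -/
theorem exists_dominating_functionals {p : ℝ≥0∞} [Fact (1 ≤ p)] (hp : p ≠ ∞) {S : F →L[𝕜] G}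
    {C : ℝ} (hC : 0 < C) (hS : ∀ (n : ℕ) (x : Fin n → F),
      ‖(WithLp.toLp p (fun k => S (x k)) : PiLp p (fun _ : Fin n => G))‖ ≤ C * weakLpNorm 𝕜 p x)
    {n : ℕ} (x : Fin n → F) {ε : ℝ} (hε : 0 < ε) :
    ∃ (κ : Type) (_ : Fintype κ) (ψ : κ → F →L[𝕜] 𝕜), (∑ k, ‖ψ k‖ ^ p.toReal ≤ 1) ∧
      ∀ i, ‖S (x i)‖ ^ p.toReal ≤ C ^ p.toReal * (∑ k, ‖ψ k (x i)‖ ^ p.toReal) + ε := by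
  set q := p.toReal with hq
  have hq1 : 1 ≤ q := by
    rw [hq, ← ENNReal.toReal_one]
    exact ENNReal.toReal_mono hp Fact.out
  have hq0 : 0 < q := by linarith
  let V : Set (Fin n → ℝ) := Set.range fun φ : Metric.closedBall (0 : F →L[𝕜] 𝕜) 1 =>
    fun i => C ^ q * ‖φ.1 (x i)‖ ^ q
  have hdom : ∀ l : Fin n → ℝ, (∀ i, 0 ≤ l i) → ∀ δ : ℝ, 0 < δ →
      ∃ v ∈ V, ∑ i, l i * ‖S (x i)‖ ^ q ≤ ∑ i, l i * v i + δ := by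
    intro l hl δ hδ
    by_contra! hcon
    set A := ∑ i, l i * ‖S (x i)‖ ^ q with hA
    -- The weights are absorbed into the vectors, so that the summing inequality applies to weighted
    -- sums of `q`-th powers.
    let y : Fin n → F := fun i => ((l i ^ (1 / q) : ℝ) : 𝕜) • x i
    have hpow : ∀ i, |l i ^ (1 / q)| ^ q = l i := fun i => by
      rw [abs_of_nonneg (Real.rpow_nonneg (hl i) _), ← Real.rpow_mul (hl i),
        one_div_mul_cancel hq0.ne', Real.rpow_one]
    have hSy : ‖(WithLp.toLp p (fun k => S (y k)) : PiLp p (fun _ : Fin n => G))‖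
        = A ^ (1 / q) := by
      rw [PiLp.norm_eq_sum hq0, hA]
      congr 1
      refine Finset.sum_congr rfl fun i _ => ?_
      change ‖S (((l i ^ (1 / q) : ℝ) : 𝕜) • x i)‖ ^ q = _
      rw [map_smul, norm_smul, Real.mul_rpow (norm_nonneg _) (norm_nonneg _), RCLike.norm_ofReal,
        hpow]
    have hφ : ∀ φ : Metric.closedBall (0 : F →L[𝕜] 𝕜) 1,
        C ^ q * ∑ i, l i * ‖φ.1 (x i)‖ ^ q + δ < A := fun φ => by
      have := hcon _ ⟨φ, rfl⟩
      rw [Finset.mul_sum]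
      simpa only [mul_left_comm] using this
    have hAδ : 0 ≤ A - δ := by
      have := hφ ⟨0, by simp⟩
      simp [Real.zero_rpow hq0.ne'] at this
      linarith
    have : Nonempty (Metric.closedBall (0 : F →L[𝕜] 𝕜) 1) := ⟨⟨0, by simp⟩⟩
    have hweak : weakLpNorm 𝕜 p y ≤ (A - δ) ^ (1 / q) / C := by
      refine ciSup_le fun φ => ?_
      have h0 : 0 ≤ ∑ i, l i * ‖φ.1 (x i)‖ ^ q :=
        Finset.sum_nonneg fun i _ => mul_nonneg (hl i) (Real.rpow_nonneg (norm_nonneg _) _)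
      have h1 : ‖(WithLp.toLp p (fun k => φ.1 (y k)) : PiLp p (fun _ : Fin n => 𝕜))‖
          = (∑ i, l i * ‖φ.1 (x i)‖ ^ q) ^ (1 / q) := by
        rw [PiLp.norm_eq_sum hq0]
        congr 1
        refine Finset.sum_congr rfl fun i _ => ?_
        change ‖φ.1 (((l i ^ (1 / q) : ℝ) : 𝕜) • x i)‖ ^ q = _
        rw [map_smul, norm_smul, Real.mul_rpow (norm_nonneg _) (norm_nonneg _),
          RCLike.norm_ofReal, hpow]
      rw [h1, le_div_iff₀ hC, mul_comm]
      have h2 : C = (C ^ q) ^ (1 / q) := by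
        rw [← Real.rpow_mul hC.le, mul_one_div_cancel hq0.ne', Real.rpow_one]
      conv_lhs => rw [h2]
      rw [← Real.mul_rpow (by positivity) h0]
      exact Real.rpow_le_rpow (by positivity) (by linarith [hφ φ]) (by positivity)
    have h3 : A ^ (1 / q) ≤ (A - δ) ^ (1 / q) := by
      rw [← hSy]
      refine (hS n y).trans ((mul_le_mul_of_nonneg_left hweak hC.le).trans_eq ?_)
      field_simp
    have h4 : (A - δ) ^ (1 / q) < A ^ (1 / q) :=
      Real.rpow_lt_rpow hAδ (by linarith) (by positivity)
    linarith
  -- The convex coefficients of the dominating point play the role of the Pietsch measure, here with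
  -- finite support; their `q`-th roots are absorbed into the functionals.
  obtain ⟨v, hv, hle⟩ := exists_mem_convexHull_dominating V (fun i => ‖S (x i)‖ ^ q) hdom hε
  obtain ⟨κ, _, l, z, hl0, hl1, hz, rfl⟩ := mem_convexHull_iff_exists_fintype.1 hv
  choose φ hφ using hz
  have hpow : ∀ k, |l k ^ (1 / q)| ^ q = l k := fun k => by
    rw [abs_of_nonneg (Real.rpow_nonneg (hl0 k) _), ← Real.rpow_mul (hl0 k),
      one_div_mul_cancel hq0.ne', Real.rpow_one]
  refine ⟨κ, inferInstance, fun k => ((l k ^ (1 / q) : ℝ) : 𝕜) • (φ k).1, ?_, fun i => ?_⟩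
  · refine (Finset.sum_le_sum fun k _ => ?_).trans_eq hl1
    rw [norm_smul, Real.mul_rpow (norm_nonneg _) (norm_nonneg _), RCLike.norm_ofReal, hpow]
    exact mul_le_of_le_one_right (hl0 k)
      (Real.rpow_le_one (norm_nonneg _) (mem_closedBall_zero_iff.1 (φ k).2) hq0.le)
  · refine (hle i).trans_eq ?_
    congr 1
    rw [Finset.sum_apply, Finset.mul_sum]
    refine Finset.sum_congr rfl fun k _ => ?_
    rw [← hφ k, _root_.smul_apply, Pi.smul_apply, norm_smul,
      Real.mul_rpow (norm_nonneg _) (norm_nonneg _), RCLike.norm_ofReal, hpow, smul_eq_mul]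
    ring

theorem LocallyConcave.isSumming_one [NormedSpace ℝ F] [IsScalarTower ℝ 𝕜 F] {r c : ℝ}
    (h : LocallyConcave 𝕜 F r c) (hc : 0 ≤ c) {p : ℝ≥0∞} (hp : p ≠ ∞)
    (hrp : r.HolderConjugate p.toReal) {S : F →L[𝕜] G} (hS : IsSumming p S) : IsSumming 1 S := by
  have hq0 : 0 < p.toReal := hrp.symm.pos
  have : Fact (1 ≤ p) := ⟨by
    rw [← ENNReal.ofReal_toReal hp, ← ENNReal.ofReal_one]
    exact ENNReal.ofReal_le_ofReal hrp.symm.lt.le⟩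
  obtain ⟨C, hC, hS⟩ := hS
  -- The constant is enlarged to `C + 1` because domination divides by it.
  have hS' : ∀ (n : ℕ) (x : Fin n → F),
      ‖(WithLp.toLp p (fun k => S (x k)) : PiLp p (fun _ : Fin n => G))‖
        ≤ (C + 1) * weakLpNorm 𝕜 p x := fun n x =>
    (hS n x).trans (mul_le_mul_of_nonneg_right (by linarith) (weakLpNorm_nonneg p x))
  refine ⟨(C + 1) * (2 * c), by positivity, fun n x => ?_⟩
  set w := weakLpNorm 𝕜 1 x with hw
  have hw0 : 0 ≤ w := weakLpNorm_nonneg 1 x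
  rw [norm_toLp_one]
  have key : ∀ δ : ℝ, 0 < δ → ∑ i, ‖S (x i)‖ ≤ (C + 1) * (2 * c) * w + n * δ := by
    intro δ hδ
    -- The error is taken as a `p`-th power of `δ`, so that it becomes `δ` after the root.
    obtain ⟨κ, _, ψ, hψ, hle⟩ := exists_dominating_functionals hp (by linarith : 0 < C + 1) hS' x
      (Real.rpow_pos_of_pos hδ p.toReal)
    have hi : ∀ i, ‖S (x i)‖ ≤
        (C + 1) * (∑ k, ‖ψ k (x i)‖ ^ p.toReal) ^ (1 / p.toReal) + δ := fun i => by
      have h0 : 0 ≤ ∑ k, ‖ψ k (x i)‖ ^ p.toReal :=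
        Finset.sum_nonneg fun k _ => Real.rpow_nonneg (norm_nonneg _) _
      rw [← Real.rpow_le_rpow_iff (norm_nonneg _) (by positivity) hq0]
      refine (hle i).trans (le_trans (le_of_eq ?_) (Real.add_rpow_le_rpow_add (by positivity)
        hδ.le hrp.symm.lt.le))
      rw [Real.mul_rpow (by positivity) (by positivity), ← Real.rpow_mul h0,
        one_div_mul_cancel hq0.ne', Real.rpow_one]
    refine (Finset.sum_le_sum fun i _ => hi i).trans ?_
    rw [Finset.sum_add_distrib, ← Finset.mul_sum]
    have h2 := h.sum_norm_functional_le hc hrp x hw0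
      (fun φ hφ => sum_norm_le_weakLpNorm_one x hφ) ψ hψ
    have h3 := mul_le_mul_of_nonneg_left h2 (by linarith : 0 ≤ C + 1)
    simp only [Finset.sum_const, Finset.card_univ, Fintype.card_fin, nsmul_eq_mul]
    linarith
  refine le_of_forall_pos_le_add fun ε hε => (key (ε / (n + 1)) (by positivity)).trans ?_
  have : (n : ℝ) * (ε / (n + 1)) ≤ ε := by
    rw [mul_div_assoc', div_le_iff₀ (by positivity)]
    nlinarith
  linarith

/-- For `r = 1` the identity matrix is an admissible choice of `a`, and it shows that the identity
of `F` is already `1`-summing. -/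
theorem LocallyConcave.isSumming_one_of_one [NormedSpace ℝ F] {c : ℝ}
    (h : LocallyConcave 𝕜 F 1 c) (hc : 0 ≤ c) (S : F →L[𝕜] G) : IsSumming 1 S := by
  refine ⟨‖S‖ * c, by positivity, fun n x => ?_⟩
  have key := h n n x (fun i k => if i = k then 1 else 0) _ (weakLpNorm_nonneg 1 x)
    (fun φ hφ => sum_norm_le_weakLpNorm_one x hφ) fun i => by
      simp only [Real.rpow_one]
      simp [apply_ite abs]
  simp only [Real.rpow_one, ite_smul, one_smul, zero_smul, Finset.sum_ite_eq', Finset.mem_univ,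
    if_true] at key
  rw [norm_toLp_one, mul_assoc]
  refine (Finset.sum_le_sum fun i _ => S.le_opNorm (x i)).trans ?_
  rw [← Finset.mul_sum]
  exact mul_le_mul_of_nonneg_left key (norm_nonneg _)

end Summing

/-! ### Operators given by sequences of functionals -/

section SequenceOperator

variable {𝕜 : Type*} [RCLike 𝕜] {F : Type*} [NormedAddCommGroup F] [NormedSpace 𝕜 F]

theorem isSumming_top {G : Type*} [NormedAddCommGroup G] [NormedSpace 𝕜 G] (S : F →L[𝕜] G) :
    IsSumming ∞ S := by
  refine ⟨‖S‖, norm_nonneg _, fun n x => ?_⟩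
  rw [PiLp.norm_eq_ciSup]
  refine Real.iSup_le (fun i => ?_) (mul_nonneg (norm_nonneg _) (weakLpNorm_nonneg ∞ x))
  refine (S.le_opNorm (x i)).trans (mul_le_mul_of_nonneg_left ?_ (norm_nonneg _))
  obtain ⟨φ, hφ, hφx⟩ := exists_dual_vector'' 𝕜 (x i)
  have h1 : ‖x i‖ = ‖φ (x i)‖ := by simp [hφx]
  rw [h1]
  exact (PiLp.norm_apply_le (p := ∞) (WithLp.toLp ∞ fun k => φ (x k)) i).trans
    (norm_le_weakLpNorm ∞ x hφ)

/-- The operator `x ↦ (yₖ(x))ₖ` into `ℓ_p`. -/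
noncomputable def sequenceOperator {p : ℝ≥0∞} [Fact (1 ≤ p)]
    (y : lp (fun _ : ℕ => F →L[𝕜] 𝕜) p) : F →L[𝕜] lp (fun _ : ℕ => 𝕜) p :=
  have hp : p ≠ 0 := (zero_lt_one.trans_le (Fact.out : 1 ≤ p)).ne'
  have hle : ∀ x k, ‖y k x‖ ≤ ‖((((‖x‖ : ℝ) : 𝕜) • y : lp (fun _ : ℕ => F →L[𝕜] 𝕜) p)) k‖ :=
    fun x k => by
      rw [lp.coeFn_smul, Pi.smul_apply, norm_smul, RCLike.norm_ofReal, abs_norm, mul_comm]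
      exact (y k).le_opNorm x
  LinearMap.mkContinuous
    { toFun := fun x => ⟨fun k => y k x, (lp.memℓp _).mono' (hle x)⟩
      map_add' := fun x x' => by
        ext k
        exact map_add (y k) x x'
      map_smul' := fun a x => by
        ext k
        exact map_smul (y k) a x }
    ‖y‖ fun x => (lp.norm_mono hp (hle x)).trans_eq (by
      rw [norm_smul, RCLike.norm_ofReal, abs_norm, mul_comm])

theorem sequenceOperator_apply {p : ℝ≥0∞} [Fact (1 ≤ p)]
    (y : lp (fun _ : ℕ => F →L[𝕜] 𝕜) p) (x : F) (k : ℕ) : sequenceOperator y x k = y k x := rfl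

/-- For finite `p`, apply the weak norm estimate to each `y k` and sum over `k`; the constant is
`‖y‖`. -/
theorem isSumming_sequenceOperator {p : ℝ≥0∞} [Fact (1 ≤ p)]
    (y : lp (fun _ : ℕ => F →L[𝕜] 𝕜) p) : IsSumming p (sequenceOperator y) := by
  rcases eq_or_ne p ∞ with rfl | hp
  · exact isSumming_top _
  have hq0 : 0 < p.toReal := ENNReal.toReal_pos (zero_lt_one.trans_le (Fact.out : 1 ≤ p)).ne' hp
  refine ⟨‖y‖, norm_nonneg _, fun n x => ?_⟩
  have hw := weakLpNorm_nonneg (𝕜 := 𝕜) p x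
  have hk : ∀ k, ∑ j, ‖y k (x j)‖ ^ p.toReal ≤
      ‖y k‖ ^ p.toReal * weakLpNorm 𝕜 p x ^ p.toReal := fun k => by
    have h0 : 0 ≤ ∑ j, ‖y k (x j)‖ ^ p.toReal :=
      Finset.sum_nonneg fun _ _ => Real.rpow_nonneg (norm_nonneg _) _
    have h1 := norm_le_mul_weakLpNorm p x (y k)
    rw [PiLp.norm_eq_sum hq0] at h1
    have h2 := Real.rpow_le_rpow (by positivity) h1 hq0.le
    rwa [← Real.rpow_mul h0, one_div_mul_cancel hq0.ne', Real.rpow_one,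
      Real.mul_rpow (norm_nonneg _) hw] at h2
  rw [← Real.rpow_le_rpow_iff (norm_nonneg _) (by positivity) hq0, PiLp.norm_eq_sum hq0,
    ← Real.rpow_mul (Finset.sum_nonneg fun _ _ => Real.rpow_nonneg (norm_nonneg _) _),
    one_div_mul_cancel hq0.ne', Real.rpow_one, Real.mul_rpow (norm_nonneg _) hw]
  have hsum := hasSum_sum fun j (_ : j ∈ Finset.univ) =>
    lp.hasSum_norm hq0 (sequenceOperator y (x j))
  exact hasSum_le hk hsum ((lp.hasSum_norm hq0 y).mul_right _)

end SequenceOperator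

/-! ### Conjugate exponents and the uniform boundedness argument -/

/-- The conjugate exponent of `r` is `∞` if `r = 1`, and finite otherwise. -/
theorem conjugate_exponent_cases {r : ℝ} (hr : 1 ≤ r) {r' : ℝ≥0∞}
    (hr' : (ENNReal.ofReal r)⁻¹ + r'⁻¹ = 1) :
    (r = 1 ∧ r' = ∞) ∨ (r' ≠ ∞ ∧ r.HolderConjugate r'.toReal) := by
  have hr0 : 0 < r := by linarith
  rcases eq_or_ne r' ∞ with rfl | h
  · left
    simpa using hr'
  · right
    refine ⟨h, ?_⟩
    have h0 : r' ≠ 0 := by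
      rintro rfl
      simp at hr'
    have h1 := congrArg ENNReal.toReal hr'
    rw [ENNReal.toReal_add (by simpa using hr0) (by simpa using h0), ENNReal.toReal_inv,
      ENNReal.toReal_inv, ENNReal.toReal_ofReal hr0.le, ENNReal.toReal_one] at h1
    refine Real.holderConjugate_iff.2 ⟨?_, h1⟩
    have : 0 < r'.toReal⁻¹ := inv_pos.2 (ENNReal.toReal_pos h0 h)
    exact (one_lt_inv₀ (inv_pos.2 hr0)).2 (by linarith) |>.trans_eq (inv_inv r)

theorem sum_mul_norm_le_lp_norm {r : ℝ} (hr : 1 ≤ r) {r' : ℝ≥0∞}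
    (hr' : (ENNReal.ofReal r)⁻¹ + r'⁻¹ = 1) {E : Type*} [NormedAddCommGroup E]
    (z : lp (fun _ : ℕ => E) r') {m : ℕ} (a : Fin m → ℝ) (ha : ∑ k, |a k| ^ r ≤ 1) :
    ∑ k, |a k| * ‖z k‖ ≤ ‖z‖ := by
  have hz : 0 ≤ ‖z‖ := lp.norm_nonneg' z
  rcases conjugate_exponent_cases hr hr' with ⟨rfl, rfl⟩ | ⟨hp, hrp⟩
  · simp only [Real.rpow_one] at ha
    refine (Finset.sum_le_sum fun (k : Fin m) _ => mul_le_mul_of_nonneg_left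
      (lp.norm_apply_le_norm ENNReal.top_ne_zero z k) (abs_nonneg (a k))).trans ?_
    rw [← Finset.sum_mul]
    exact mul_le_of_le_one_left hz ha
  · have hq0 : 0 < r'.toReal := hrp.symm.pos
    have h1 : ∑ k : Fin m, ‖z k‖ ^ r'.toReal ≤ ‖z‖ ^ r'.toReal := by
      rw [Fin.sum_univ_eq_sum_range (fun k => ‖z k‖ ^ r'.toReal) m]
      exact lp.sum_rpow_le_norm_rpow hq0 z _
    refine (Real.inner_le_Lp_mul_Lq Finset.univ (fun k => |a k|) (fun k : Fin m => ‖z k‖)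
      hrp).trans ?_
    simp only [abs_abs, abs_norm]
    have h2 : (∑ k : Fin m, ‖z k‖ ^ r'.toReal) ^ (1 / r'.toReal) ≤ ‖z‖ := by
      refine (Real.rpow_le_rpow (Finset.sum_nonneg fun _ _ => Real.rpow_nonneg (norm_nonneg _) _)
        h1 (by positivity)).trans_eq ?_
      rw [← Real.rpow_mul hz, mul_one_div_cancel hq0.ne', Real.rpow_one]
    have h3 : (∑ k, |a k| ^ r) ^ (1 / r) ≤ 1 :=
      Real.rpow_le_one (Finset.sum_nonneg fun _ _ => Real.rpow_nonneg (abs_nonneg _) _) ha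
        (one_div_nonneg.2 hrp.nonneg)
    calc _ ≤ 1 * ‖z‖ := mul_le_mul h3 h2 (Real.rpow_nonneg
          (Finset.sum_nonneg fun _ _ => Real.rpow_nonneg (norm_nonneg _) _) _) zero_le_one
      _ = ‖z‖ := one_mul _

/-- Norming functionals of the `v k`, multiplied by dual weights and extended by zero. For `r = 1`
all weights are one, since only boundedness of the sequence is needed. -/
theorem exists_norming_lp {r : ℝ} (hr : 1 ≤ r) {r' : ℝ≥0∞}
    (hr' : (ENNReal.ofReal r)⁻¹ + r'⁻¹ = 1) {𝕜 : Type*} [RCLike 𝕜] {F : Type*}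
    [NormedAddCommGroup F] [NormedSpace 𝕜 F] {m : ℕ} (v : Fin m → F) :
    ∃ y : lp (fun _ : ℕ => F →L[𝕜] 𝕜) r', ‖y‖ ≤ 1 ∧
      ∑ k : Fin m, y k (v k) = (((∑ k, ‖v k‖ ^ r) ^ (1 / r) : ℝ) : 𝕜) := by
  choose ψ hψ1 hψ using fun k => exists_dual_vector'' 𝕜 (v k)
  let y : (Fin m → ℝ) → ℕ → F →L[𝕜] 𝕜 := fun b k =>
    if h : k < m then (b ⟨k, h⟩ : 𝕜) • ψ ⟨k, h⟩ else 0
  have hy : ∀ b (k : Fin m), y b k (v k) = ((b k * ‖v k‖ : ℝ) : 𝕜) := fun b k => by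
    simp [y, hψ]
  have hynorm : ∀ b (k : Fin m), ‖y b k‖ ≤ |b k| := fun b k => by
    simp only [y, k.2, dite_true, norm_smul, RCLike.norm_ofReal]
    exact mul_le_of_le_one_right (abs_nonneg _) (hψ1 k)
  have hyzero : ∀ b (k : ℕ), ¬ k < m → y b k = 0 := fun b k hk => by simp [y, hk]
  have hfinish : ∀ b, ∑ k, b k * ‖v k‖ = (∑ k, ‖v k‖ ^ r) ^ (1 / r) →
      ∑ k : Fin m, y b k (v k) = (((∑ k, ‖v k‖ ^ r) ^ (1 / r) : ℝ) : 𝕜) := fun b hb => by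
    simp only [hy, ← hb, RCLike.ofReal_sum]
  rcases conjugate_exponent_cases hr hr' with ⟨rfl, rfl⟩ | ⟨hp, hrp⟩
  · have hle : ∀ k, ‖y 1 k‖ ≤ 1 := fun k => by
      by_cases hk : k < m
      · simpa using hynorm 1 ⟨k, hk⟩
      · simp [hyzero 1 k hk]
    refine ⟨⟨y 1, memℓp_infty ⟨1, by rintro _ ⟨k, rfl⟩; exact hle k⟩⟩,
      lp.norm_le_of_forall_le zero_le_one hle, hfinish 1 (by simp)⟩
  · have hq0 : 0 < r'.toReal := hrp.symm.pos
    obtain ⟨b, hb0, hb1, hb⟩ := exists_dual_weights hrp (fun k => ‖v k‖) fun k => norm_nonneg _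
    have hle : ∀ s : Finset ℕ, ∑ k ∈ s, ‖y b k‖ ^ r'.toReal ≤ 1 := fun s => by
      calc ∑ k ∈ s, ‖y b k‖ ^ r'.toReal
          ≤ ∑ k ∈ s ∪ Finset.range m, ‖y b k‖ ^ r'.toReal :=
            Finset.sum_le_sum_of_subset_of_nonneg Finset.subset_union_left
              fun _ _ _ => Real.rpow_nonneg (norm_nonneg _) _
        _ = ∑ k ∈ Finset.range m, ‖y b k‖ ^ r'.toReal := by
            refine (Finset.sum_subset Finset.subset_union_right fun k _ hk => ?_).symm
            rw [Finset.mem_range] at hk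
            rw [hyzero b k hk, norm_zero, Real.zero_rpow hq0.ne']
        _ ≤ ∑ k, b k ^ r'.toReal := by
            rw [← Fin.sum_univ_eq_sum_range (fun k => ‖y b k‖ ^ r'.toReal) m]
            exact Finset.sum_le_sum fun k _ => Real.rpow_le_rpow (norm_nonneg _)
              ((hynorm b k).trans_eq (abs_of_nonneg (hb0 k))) hq0.le
        _ ≤ 1 := hb1
    refine ⟨⟨y b, memℓp_gen' hle⟩, lp.norm_le_of_forall_sum_le hq0 zero_le_one fun s => ?_,
      hfinish b hb⟩
    rw [Real.one_rpow]
    exact hle s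

theorem exists_locallyConcave_of_isSumming {𝕜 : Type*} [RCLike 𝕜] {F : Type*}
    [NormedAddCommGroup F] [NormedSpace 𝕜 F] [NormedSpace ℝ F] [IsScalarTower ℝ 𝕜 F]
    {r : ℝ} (hr : 1 ≤ r) {r' : ℝ≥0∞} [Fact (1 ≤ r')] (hr' : (ENNReal.ofReal r)⁻¹ + r'⁻¹ = 1)
    (h : ∀ y : lp (fun _ : ℕ => F →L[𝕜] 𝕜) r', IsSumming 1 (sequenceOperator y)) :
    ∃ c : ℝ, 0 ≤ c ∧ LocallyConcave 𝕜 F r c := by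
  have hr0 : 0 < r := by linarith
  let ι := {g : Σ n : ℕ, Σ m : ℕ, (Fin n → F) × (Fin n → Fin m → ℝ) //
    (∀ φ : F →L[𝕜] 𝕜, ‖φ‖ ≤ 1 → ∑ i, ‖φ (g.2.2.1 i)‖ ≤ 1) ∧ ∀ i, ∑ k, |g.2.2.2 i k| ^ r ≤ 1}
  let L : ι → lp (fun _ : ℕ => F →L[𝕜] 𝕜) r' →L[𝕜] 𝕜 := fun g =>
    ∑ k : Fin g.1.2.1, (ContinuousLinearMap.apply 𝕜 𝕜 (∑ i, g.1.2.2.2 i k • g.1.2.2.1 i)).comp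
      (lp.evalCLM 𝕜 (fun _ : ℕ => F →L[𝕜] 𝕜) r' k)
  have hL : ∀ g y, L g y = ∑ k : Fin g.1.2.1, y k (∑ i, g.1.2.2.2 i k • g.1.2.2.1 i) :=
    fun g y => by
      simp only [L, _root_.sum_apply]
      rfl
  -- At a fixed `y`, Hölder along each row of `a` bounds the functionals by `∑ᵢ ‖S_y xᵢ‖`, where
  -- `S_y` is the sequence operator, and its `1`-summing constant bounds this for all normalized
  -- data at once.
  obtain ⟨C, hC⟩ := banach_steinhaus (g := L) fun y => by
    obtain ⟨c, hc, hy⟩ := h y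
    refine ⟨c, ?_⟩
    rintro ⟨⟨n, m, x, a⟩, hx, ha⟩
    rw [hL]
    have h1 : ∀ i, ∑ k : Fin m, ‖y k (a i k • x i)‖ ≤ ‖sequenceOperator y (x i)‖ := fun i => by
      refine le_trans (le_of_eq ?_)
        (sum_mul_norm_le_lp_norm hr hr' (sequenceOperator y (x i)) (a i) (ha i))
      refine Finset.sum_congr rfl fun k _ => ?_
      rw [← algebraMap_smul 𝕜 (a i k) (x i), map_smul, norm_smul, norm_algebraMap',
        sequenceOperator_apply, Real.norm_eq_abs]
    have h2 := hy n x
    rw [norm_toLp_one] at h2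
    calc ‖∑ k : Fin m, y k (∑ i, a i k • x i)‖
        ≤ ∑ k : Fin m, ∑ i, ‖y k (a i k • x i)‖ := by
          refine (norm_sum_le _ _).trans (Finset.sum_le_sum fun k _ => ?_)
          rw [map_sum]
          exact norm_sum_le _ _
      _ = ∑ i, ∑ k : Fin m, ‖y k (a i k • x i)‖ := Finset.sum_comm
      _ ≤ ∑ i, ‖sequenceOperator y (x i)‖ := Finset.sum_le_sum fun i _ => h1 i
      _ ≤ c * weakLpNorm 𝕜 1 x := h2
      _ ≤ c := mul_le_of_le_one_right hc (weakLpNorm_one_le x hx)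
  refine ⟨|C|, abs_nonneg _, LocallyConcave.of_unit hr (abs_nonneg _) fun n m x a hx ha => ?_⟩
  obtain ⟨y, hy1, hy⟩ := exists_norming_lp hr hr' (𝕜 := 𝕜) fun k => ∑ i, a i k • x i
  have hS : 0 ≤ ∑ k, ‖∑ i, a i k • x i‖ ^ r :=
    Finset.sum_nonneg fun _ _ => Real.rpow_nonneg (norm_nonneg _) _
  have h1 : (∑ k, ‖∑ i, a i k • x i‖ ^ r) ^ (1 / r) ≤ |C| := by
    have h2 : ‖L ⟨⟨n, m, x, a⟩, hx, ha⟩ y‖ = (∑ k, ‖∑ i, a i k • x i‖ ^ r) ^ (1 / r) := by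
      rw [hL, hy, RCLike.norm_ofReal, abs_of_nonneg (Real.rpow_nonneg hS _)]
    rw [← h2]
    refine (ContinuousLinearMap.le_opNorm _ _).trans ?_
    exact (mul_le_of_le_one_right (norm_nonneg _) hy1).trans ((hC _).trans (le_abs_self _))
  have h2 := Real.rpow_le_rpow (Real.rpow_nonneg hS _) h1 hr0.le
  rwa [← Real.rpow_mul hS, one_div_mul_cancel hr0.ne', Real.rpow_one] at h2

-- Independence of the universe of the target spaces

universe w

theorem small_lp_nat (𝕜 : Type*) [RCLike 𝕜] (p : ℝ≥0∞) :
    Small.{w} (lp (fun _ : ℕ => 𝕜) p) := by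
  have : Small.{w} 𝕜 := small_of_injective (β := ℝ × ℝ)
    (f := fun z : 𝕜 => (RCLike.re z, RCLike.im z)) fun z z' h =>
      RCLike.ext (congrArg Prod.fst h) (congrArg Prod.snd h)
  exact small_of_injective (β := ℕ → 𝕜) (f := fun x : lp (fun _ : ℕ => 𝕜) p => (x : ℕ → 𝕜))
    fun x x' h => lp.ext h

theorem IsSumming.congr_norm {𝕜 : Type*} [RCLike 𝕜] {E G G' : Type*} [NormedAddCommGroup E]
    [NormedSpace 𝕜 E] [NormedAddCommGroup G] [NormedSpace 𝕜 G] [NormedAddCommGroup G']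
    [NormedSpace 𝕜 G'] {p : ℝ≥0∞} [Fact (1 ≤ p)] {S : E →L[𝕜] G} {S' : E →L[𝕜] G'}
    (hS : IsSumming p S) (h : ∀ x, ‖S' x‖ = ‖S x‖) : IsSumming p S' := by
  obtain ⟨c, hc, hS⟩ := hS
  refine ⟨c, hc, fun n x => le_trans (le_of_eq ?_) (hS n x)⟩
  rcases eq_or_ne p ∞ with rfl | hp
  · simp only [PiLp.norm_eq_ciSup, h]
  · have hq0 : 0 < p.toReal :=
      ENNReal.toReal_pos (zero_lt_one.trans_le (Fact.out : 1 ≤ p)).ne' hp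
    simp only [PiLp.norm_eq_sum hq0, h]

/-- Summing operators into an arbitrary universe suffice for local concavity. -/
theorem exists_locallyConcave_of_summing_inclusion {𝕜 : Type*} [RCLike 𝕜] {F : Type*}
    [NormedAddCommGroup F] [NormedSpace 𝕜 F] [NormedSpace ℝ F] [IsScalarTower ℝ 𝕜 F]
    {r : ℝ} (hr : 1 ≤ r) {r' : ℝ≥0∞} (hr' : (ENNReal.ofReal r)⁻¹ + r'⁻¹ = 1)
    (h : ∀ (G : Type w) [NormedAddCommGroup G] [NormedSpace 𝕜 G] [CompleteSpace G]
      (S : F →L[𝕜] G), IsSumming r' S → IsSumming 1 S) :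
    ∃ c : ℝ, 0 ≤ c ∧ LocallyConcave 𝕜 F r c := by
  have : Fact (1 ≤ r') := ⟨by
    rw [← ENNReal.inv_le_one, ← hr']
    exact le_add_self⟩
  refine exists_locallyConcave_of_isSumming hr hr' fun y => ?_
  have := small_lp_nat.{w} 𝕜 r'
  -- The target `ℓ_{r'}` is replaced by an isometric copy in the universe over which the hypothesis
  -- quantifies.
  let e : Shrink.{w} (lp (fun _ : ℕ => 𝕜) r') ≃ₗᵢ[𝕜] lp (fun _ : ℕ => 𝕜) r' :=
    ⟨Shrink.linearEquiv 𝕜 _, fun _ => rfl⟩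
  have : CompleteSpace (Shrink.{w} (lp (fun _ : ℕ => 𝕜) r')) :=
    (completeSpace_congr e.isometry.isUniformEmbedding (e := e.toEquiv)).2 inferInstance
  have h1 : IsSumming r' (e.symm.toContinuousLinearEquiv.toContinuousLinearMap.comp
      (sequenceOperator y)) :=
    (isSumming_sequenceOperator y).congr_norm fun x => e.symm.norm_map _
  exact (h _ _ h1).congr_norm fun x => (e.symm.norm_map _).symm

/-! ### The equivalence -/

theorem corollary6 {𝕜 : Type*} [RCLike 𝕜] {F : Type*} [NormedAddCommGroup F] [NormedSpace 𝕜 F]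
    [NormedSpace ℝ F] [IsScalarTower ℝ 𝕜 F] [CompleteSpace F]
    (r : ℝ) (hr : 1 ≤ r) (r' : ℝ≥0∞) (hr' : (ENNReal.ofReal r)⁻¹ + r'⁻¹ = 1) :
    List.TFAE [
      -- every `r'`-summing operator on `F` is `1`-summing
      ∀ (G : Type*) [NormedAddCommGroup G] [NormedSpace 𝕜 G] [CompleteSpace G] (S : F →L[𝕜] G),
        IsSumming r' S → IsSumming 1 S,
      -- every operator from a (real) Banach lattice into `F` is `r`-concave
      ∀ (X : Type*) [NormedAddCommGroup X] [NormedSpace ℝ X] [CompleteSpace X] [Lattice X]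
        [IsOrderedAddMonoid X] [IsOrderedModule ℝ X] [HasSolidNorm X] (T : X →L[ℝ] F),
        IsConcaveOperator (zero_lt_one.trans_le hr) T,
      -- every operator from an `r`-convex quasi Banach function space into `F` is dominated
      ∀ (Ω : Type*) [MeasurableSpace Ω] (μ : Measure Ω) [SigmaFinite μ] [μ.IsComplete]
        (X : QuasiBanachFunctionSpace μ), X.IsConvex r →
        ∀ T : X.carrier →ₗ[ℝ] F, (∃ C : ℝ, ∀ x : X.carrier, ‖T x‖ ≤ C * X.qnorm x) →
          ∃ φ : X.power (zero_lt_one.trans_le hr) →ₗ[ℝ] ℝ,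
            (∀ f : X.power (zero_lt_one.trans_le hr), 0 ≤ f.1 → 0 ≤ φ f) ∧
            BddAbove {s : ℝ | ∃ x : X.carrier, X.qnorm x ≤ 1 ∧
              s = φ (X.absPowMap (zero_lt_one.trans_le hr) x) ^ (1 / r)} ∧
            ∀ x : X.carrier,
              ‖T x‖ ≤ φ (X.absPowMap (zero_lt_one.trans_le hr) x) ^ (1 / r)] := by
  have hr0 : 0 < r := zero_lt_one.trans_le hr
  have h1 (c : ℝ) (hc : 0 ≤ c) (hL : LocallyConcave 𝕜 F r c) (G : Type _) [NormedAddCommGroup G]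
      [NormedSpace 𝕜 G] (S : F →L[𝕜] G) (hS : IsSumming r' S) : IsSumming 1 S := by
    rcases conjugate_exponent_cases hr hr' with ⟨rfl, -⟩ | ⟨hp, hrp⟩
    · exact hL.isSumming_one_of_one hc S
    · exact hL.isSumming_one hc hp hrp hS
  tfae_have 1 → 2 := fun h X _ _ _ _ _ _ _ T => by
    obtain ⟨c, hc, hL⟩ := exists_locallyConcave_of_summing_inclusion hr hr' h
    exact hL.isConcaveOperator hc hr0 T
  tfae_have 2 → 3 := fun h Ω _ μ _ _ X hX T hT => by
    obtain ⟨c, hc, hL⟩ := (concaveOnBoundedSequences_of_isConcaveOperator hr0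
      fun T => h _ T).exists_locallyConcave (𝕜 := 𝕜) hr
    exact hL.exists_dominating_functional hc hr0 X.toQuasiKotheSpace hX T hT
  tfae_have 3 → 1 := fun h G _ _ _ S hS => by
    have hcomplete := Measure.count_isComplete (ULift ℕ)
    obtain ⟨c, hc, hL⟩ := (concaveOnBoundedSequences_of_dominated hr0 fun T hT => by
      obtain ⟨φ, hpos, -, hφ⟩ := h (ULift ℕ) Measure.count (boundedFunctionSpace (ULift ℕ))
        (boundedFunctionSpace_isConvex _ hr0) T hT
      exact ⟨φ, hpos, hφ⟩).exists_locallyConcave (𝕜 := 𝕜) hr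
    exact h1 c hc hL G S hS
  tfae_finish
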